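/- Let $a,b:\mathbb Z\to\mathbb R$ with $a(n)>0$ for all $n$, put $(\tau f)(n)=a(n)f(n+1)+a(n-1)f(n-1)+b(n)f(n)$ and $W(f,g)(n)=a(n)\big(f(n)g(n+1)-f(n+1)g(n)\big)$, and let $H$ be a self-adjoint operator in $\ell^2(\mathbb Z)$ associated with $\tau$ and separated boundary conditions. That is, fix $z_0\in\mathbb C\setminus\mathbb R$ and nontrivial solutions $u_\pm$ of $\tau u=z_0u$ which are square summable near $\pm\infty$ and satisfy $\lim_{n\to\pm\infty}W(u_\pm,\overline{u_\pm})(n)=0$, respectively (this limit condition is automatic at a limit point endpoint, and at a limit circle endpoint it says that the boundary condition given by $u_\pm$ is self-adjoint), and let $Hf=\tau f$ on $$\mathfrak D(H)=\{f\in\ell^2(\mathbb Z)\mid \tau f\in\ell^2(\mathbb Z),\ \lim_{n\to\pm\infty}W(u_\pm,f)(n)=0\}.$$ Let $H_-$ be the restriction of $H$ to $\{-1,-2,\dots\}$ with a Dirichlet boundary condition at $0$: it acts in $\ell^2(\{-1,-2,\dots\})$ as $\tau$ with $f(0)=0$, on all $f$ such that $f$ and $\tau f$ are square summable over $\{-1,-2,\dots\}$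 and $\lim_{n\to-\infty}W(u_-,f)(n)=0$. **Theorem 3.1.** For each real $s\ge 0$ the following are equivalent: 1. The spectrum of $H_-$ is purely discrete (it consists of isolated eigenvalues of finite multiplicity) and has convergence exponent at most $s$, where the convergence exponent of $S\subseteq\mathbb C$ is $\inf\{t\ge0\mid\sum_{\mu\in S}\frac1{1+|\mu|^t}<\infty\}\in[0,\infty]$. 2. There is a real entire solution $\phi(z,n)$ of growth order at most $s$ which, for each $z\in\mathbb C$, is nontrivial and lies in the domain of $H$ near $-\infty$. Here a real entire solution is a family of entire functions $\phi(\cdot,n)$, $n\in\mathbb Z$, real-valued on $\mathbb R$, with $\tau\phi(z,\cdot)=z\,\phi(z,\cdot)$ for all $z\in\mathbb C$. It is of growth order at most $s$ if, for one (and hence for all) $n\in\mathbb Z$, both $\phi(\cdot,n)$ and $\phi(\cdot,n+1)$ are of growth order at most $s$; the growth order of an entire function $f$ is the infimum of all $\rho\ge0$ with $|f(z)|\le \mathrm e^{|z|^\rho}$ for all sufficiently large $|z|$. A sequence lies in the domain of $H$ near $-\infty$ if it coincides for all sufficiently negative $n$ with an element of $\mathfrak D(H)$. -/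

import Mathlib

open Filter Topology
open scoped NNReal ENNReal

noncomputable section

namespace Jacobi

/-! ### The Jacobi difference expression and its Wronskian -/

/-- The difference expression
`(τ f)(n) = a(n) f(n+1) + a(n-1) f(n-1) + b(n) f(n)`, acting on all sequences. -/
def tau (a b : ℤ → ℝ) : (ℤ → ℂ) →ₗ[ℂ] (ℤ → ℂ) where
  toFun f n := (a n : ℂ) * f (n + 1) + (a (n - 1) : ℂ) * f (n - 1) + (b n : ℂ) * f n
  map_add' f g := by
    funext n
    simp only [Pi.add_apply]
    ring
  map_smul' c f := by
    funext n
    simp only [Pi.smul_apply, smul_eq_mul, RingHom.id_apply]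
    ring

/-- The modified Wronskian `W(f,g)(n) = a(n) (f(n) g(n+1) - f(n+1) g(n))`, as a linear
function of `g`. -/
def wronskian (a : ℤ → ℝ) (f : ℤ → ℂ) : (ℤ → ℂ) →ₗ[ℂ] (ℤ → ℂ) where
  toFun g n := (a n : ℂ) * (f n * g (n + 1) - f (n + 1) * g n)
  map_add' g h := by
    funext n
    simp only [Pi.add_apply]
    ring
  map_smul' c g := by
    funext n
    simp only [Pi.smul_apply, smul_eq_mul, RingHom.id_apply]
    ring

/-- `f` is square summable near the endpoint described by the filter `l`
(`atBot` for `-∞`, `atTop` for `+∞`). -/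
def SqSummableNear (l : Filter ℤ) (f : ℤ → ℂ) : Prop :=
  ∃ s ∈ l, Summable fun n : s => ‖f n‖ ^ 2

/-- `u` is a nontrivial solution of `τ u = z₀ u` that is square summable near the endpoint `l`
and fixes a self-adjoint boundary condition `lim W(u,f) = 0` there.  The last field says that
this boundary condition is self-adjoint (equivalently, real up to a constant factor).  In the
limit point case the last field, as well as the condition `lim W(u,f) = 0` for `f` in the maximal
domain, hold automatically; in the limit circle case the self-adjoint boundary conditions
at `l` correspond exactly to the possible `u`, up to constant multiples. -/
structure IsBoundarySolution (a b : ℤ → ℝ) (z₀ : ℂ) (l : Filter ℤ) (u : ℤ → ℂ) : Prop where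
  solution : tau a b u = z₀ • u
  nontrivial : u ≠ 0
  sqSummable : SqSummableNear l u
  selfAdjoint : Tendsto (wronskian a u (star u)) l (𝓝 0)

/-! ### The operators on the whole line and on the left half line -/

/-- The Hilbert space `ℓ²(ℤ)`. -/
abbrev L2Z : Type := lp (fun _ : ℤ => ℂ) 2

/-- The Hilbert space `ℓ²(-ℕ)`, where `-ℕ = {-1, -2, …}`. -/
abbrev L2Neg : Type := lp (fun _ : {n : ℤ // n < 0} => ℂ) 2

theorem tendsto_add_zero {l : Filter ℤ} {u v : ℤ → ℂ} (hu : Tendsto u l (𝓝 0))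
    (hv : Tendsto v l (𝓝 0)) : Tendsto (u + v) l (𝓝 0) := by
  have h := Tendsto.add hu hv
  rwa [add_zero] at h

theorem tendsto_smul_zero {l : Filter ℤ} {u : ℤ → ℂ} (c : ℂ) (hu : Tendsto u l (𝓝 0)) :
    Tendsto (c • u) l (𝓝 0) := by
  have h := Tendsto.const_smul hu c
  rwa [smul_zero] at h

/-- The set of `f ∈ ℓ²(ℤ)` with `τ f ∈ ℓ²(ℤ)` and `W(u₋,f)(n) → 0` as `n → -∞`,
`W(u₊,f)(n) → 0` as `n → +∞`. -/
def domH (a b : ℤ → ℝ) (uMinus uPlus : ℤ → ℂ) : Submodule ℂ L2Z where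
  carrier := {f | Memℓp (tau a b (f : ℤ → ℂ)) 2 ∧
    Tendsto (wronskian a uMinus (f : ℤ → ℂ)) atBot (𝓝 0) ∧
    Tendsto (wronskian a uPlus (f : ℤ → ℂ)) atTop (𝓝 0)}
  add_mem' := by
    rintro f g ⟨hf, hf1, hf2⟩ ⟨hg, hg1, hg2⟩
    refine ⟨?_, ?_, ?_⟩
    · rw [lp.coeFn_add, map_add]
      exact hf.add hg
    · rw [lp.coeFn_add, map_add]
      exact tendsto_add_zero hf1 hg1
    · rw [lp.coeFn_add, map_add]
      exact tendsto_add_zero hf2 hg2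
  zero_mem' := by
    refine ⟨?_, ?_, ?_⟩
    · rw [lp.coeFn_zero, map_zero]
      exact zero_memℓp
    · rw [lp.coeFn_zero, map_zero]
      exact tendsto_const_nhds
    · rw [lp.coeFn_zero, map_zero]
      exact tendsto_const_nhds
  smul_mem' := by
    rintro c f ⟨hf, hf1, hf2⟩
    refine ⟨?_, ?_, ?_⟩
    · rw [lp.coeFn_smul, map_smul]
      exact hf.const_smul c
    · rw [lp.coeFn_smul, map_smul]
      exact tendsto_smul_zero c hf1
    · rw [lp.coeFn_smul, map_smul]
      exact tendsto_smul_zero c hf2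

/-- The Jacobi operator `H f = τ f` in `ℓ²(ℤ)` with domain `domH`. -/
def opH (a b : ℤ → ℝ) (uMinus uPlus : ℤ → ℂ) : L2Z →ₗ.[ℂ] L2Z where
  domain := domH a b uMinus uPlus
  toFun :=
    { toFun := fun f => ⟨tau a b ((f : L2Z) : ℤ → ℂ), f.2.1⟩
      map_add' := fun f g => by
        apply lp.ext
        simp only [Submodule.coe_add, lp.coeFn_add, map_add]
      map_smul' := fun c f => by
        apply lp.ext
        simp only [Submodule.coe_smul, lp.coeFn_smul, map_smul, RingHom.id_apply] }

/-- Extension of a sequence on `-ℕ` by zero to `ℤ`; in particular its value at `0` is `0`,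
which is the Dirichlet condition. -/
def extendNeg : ({n : ℤ // n < 0} → ℂ) →ₗ[ℂ] (ℤ → ℂ) where
  toFun f n := if h : n < 0 then f ⟨n, h⟩ else 0
  map_add' f g := by
    funext n
    by_cases h : n < 0 <;> simp [h]
  map_smul' c f := by
    funext n
    by_cases h : n < 0 <;> simp [h]

/-- The expression `τ` on `-ℕ` with Dirichlet boundary condition `f(0) = 0`. -/
def tauNeg (a b : ℤ → ℝ) : ({n : ℤ // n < 0} → ℂ) →ₗ[ℂ] ({n : ℤ // n < 0} → ℂ) where
  toFun f n := tau a b (extendNeg f) n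
  map_add' f g := by
    funext n
    simp only [map_add, Pi.add_apply]
  map_smul' c f := by
    funext n
    simp only [map_smul, Pi.smul_apply, RingHom.id_apply]

/-- The domain of `H₋`: all `f ∈ ℓ²(-ℕ)` with `τ f ∈ ℓ²(-ℕ)` (where `f(0) = 0`) that satisfy
the boundary condition of `H` at `-∞`. -/
def domHminus (a b : ℤ → ℝ) (uMinus : ℤ → ℂ) : Submodule ℂ L2Neg where
  carrier := {f | Memℓp (tauNeg a b (f : {n : ℤ // n < 0} → ℂ)) 2 ∧
    Tendsto (wronskian a uMinus (extendNeg (f : {n : ℤ // n < 0} → ℂ))) atBot (𝓝 0)}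
  add_mem' := by
    rintro f g ⟨hf, hf1⟩ ⟨hg, hg1⟩
    refine ⟨?_, ?_⟩
    · rw [lp.coeFn_add, map_add]
      exact hf.add hg
    · rw [lp.coeFn_add, map_add, map_add]
      exact tendsto_add_zero hf1 hg1
  zero_mem' := by
    refine ⟨?_, ?_⟩
    · rw [lp.coeFn_zero, map_zero]
      exact zero_memℓp
    · rw [lp.coeFn_zero, map_zero, map_zero]
      exact tendsto_const_nhds
  smul_mem' := by
    rintro c f ⟨hf, hf1⟩
    refine ⟨?_, ?_⟩
    · rw [lp.coeFn_smul, map_smul]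
      exact hf.const_smul c
    · rw [lp.coeFn_smul, map_smul, map_smul]
      exact tendsto_smul_zero c hf1

/-- The operator `H₋` in `ℓ²(-ℕ)`: the restriction of `H` to `-ℕ` with a Dirichlet boundary
condition at `0`. -/
def opHminus (a b : ℤ → ℝ) (uMinus : ℤ → ℂ) : L2Neg →ₗ.[ℂ] L2Neg where
  domain := domHminus a b uMinus
  toFun :=
    { toFun := fun f => ⟨tauNeg a b ((f : L2Neg) : {n : ℤ // n < 0} → ℂ), f.2.1⟩
      map_add' := fun f g => by
        apply lp.ext
        simp only [Submodule.coe_add, lp.coeFn_add, map_add]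
      map_smul' := fun c f => by
        apply lp.ext
        simp only [Submodule.coe_smul, lp.coeFn_smul, map_smul, RingHom.id_apply] }

/-- A sequence lies in the domain of `H` near `-∞` if it agrees near `-∞` with an element of the
domain of `H`. -/
def InDomainNearBot (a b : ℤ → ℝ) (uMinus uPlus : ℤ → ℂ) (f : ℤ → ℂ) : Prop :=
  ∃ g : L2Z, g ∈ (opH a b uMinus uPlus).domain ∧ ∀ᶠ n in atBot, f n = (g : ℤ → ℂ) n

/-! ### Spectra of unbounded operators -/

section Spectrum

variable {E : Type*} [NormedAddCommGroup E] [NormedSpace ℂ E]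

/-- `z` is in the resolvent set of `T`: the operator `T - z` is a bijection from the domain of `T`
onto the whole space with bounded inverse `R`. -/
def IsResolventPoint (T : E →ₗ.[ℂ] E) (z : ℂ) : Prop :=
  ∃ R : E →L[ℂ] E,
    (∀ g : E, ∃ h : R g ∈ T.domain, T ⟨R g, h⟩ - z • R g = g) ∧
    ∀ f : T.domain, R (T f - z • (f : E)) = f

/-- The spectrum of an unbounded operator. -/
def spec (T : E →ₗ.[ℂ] E) : Set ℂ :=
  {z | ¬ IsResolventPoint T z}

/-- The kernel of `T - z`. -/
def eigenspace (T : E →ₗ.[ℂ] E) (z : ℂ) : Submodule ℂ T.domain :=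
  LinearMap.ker (T.toFun - z • T.domain.subtype)

/-- The discrete spectrum: isolated points of the spectrum that are eigenvalues of finite
multiplicity. -/
def discreteSpec (T : E →ₗ.[ℂ] E) : Set ℂ :=
  {z | z ∈ spec T ∧ (∃ ε > 0, ∀ w ∈ spec T, dist w z < ε → w = z) ∧
    eigenspace T z ≠ ⊥ ∧ FiniteDimensional ℂ (eigenspace T z)}

/-- The spectrum is purely discrete if it coincides with the discrete spectrum. -/
def HasPurelyDiscreteSpectrum (T : E →ₗ.[ℂ] E) : Prop :=
  spec T = discreteSpec T

end Spectrum

/-! ### Convergence exponents and growth orders -/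

/-- The convergence exponent `inf {t ≥ 0 | ∑_{μ ∈ S} 1 / (1 + |μ|^t) < ∞} ∈ [0,∞]`. -/
def convergenceExponent (S : Set ℂ) : ℝ≥0∞ :=
  ⨅ (t : ℝ≥0) (_ : Summable fun μ : S => 1 / (1 + ‖(μ : ℂ)‖ ^ (t : ℝ))), (t : ℝ≥0∞)

/-- The growth order of `f`: the infimum in `[0,∞]` of all `ρ ≥ 0` such that
`|f(z)| ≤ exp(|z|^ρ)` for all `z` with sufficiently large modulus. -/
def growthOrder (f : ℂ → ℂ) : ℝ≥0∞ :=
  ⨅ (ρ : ℝ≥0) (_ : ∀ᶠ z in Bornology.cobounded ℂ, ‖f z‖ ≤ Real.exp (‖z‖ ^ (ρ : ℝ))),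
    (ρ : ℝ≥0∞)

/-- A real entire solution `φ(z,n)` of `τ φ = z φ`: each `φ(·,n)` is an entire function which is
real on the real line, and `φ(z,·)` solves the equation for each `z`. -/
structure IsRealEntireSolution (a b : ℤ → ℝ) (φ : ℂ → ℤ → ℂ) : Prop where
  entire : ∀ n, Differentiable ℂ fun z => φ z n
  real : ∀ n, ∀ x : ℝ, (φ x n).im = 0
  solution : ∀ z, tau a b (φ z) = z • φ z

/-- A solution is of growth order at most `s` if `φ(·,n)` and `φ(·,n+1)` are of growth order at
most `s` for one (by the recurrence, equivalently for all) `n`. -/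
def GrowthOrderAtMost (φ : ℂ → ℤ → ℂ) (s : ℝ≥0) : Prop :=
  ∃ n : ℤ, growthOrder (fun z => φ z n) ≤ s ∧ growthOrder (fun z => φ z (n + 1)) ≤ s

end Jacobi

end

/-!
For both implications `H₋` is handled through solutions of `τ f = z f` alone; neither Weyl's
alternative nor the spectral theorem enters.

*Symmetry.* For the boundary solution `u`, Green's formula expresses `lim W(u, f)` at `-∞` by
`f(-1)` and the inner product of `(τ - z₀) f` with `ū`, so the boundary condition is closed in the
graph norm and `H₋` is a closed operator. The functions that are multiples of `u` near `-∞` satisfy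
`‖(H₋ - z₀) f‖ ≥ |Im z₀| ‖f‖` because `W(ū, u) → 0`, and `H₋ - z₀` maps them onto a space
containing all finitely supported vectors. Hence they form a core and `H₋` is symmetric
(`IsBoundarySolution.isFormalAdjoint`); limit point and limit circle case need not be distinguished.

*A maximum principle.* If `F` is holomorphic in a disc with real centre `x` and radius `r` and
`|F(w)| |Im w| ≤ M` on its boundary, then `F` is bounded by `3 M / r` on the concentric disc of
radius `r / 2`, since `|(w - x)² - r²| = 2 r |Im w|` on the circle (`norm_le_of_norm_mul_im_le`). It turns the
symmetry bound `‖(H₋ - z)⁻¹‖ ≤ 1 / |Im z|` into information at real points, three times below.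

*From a solution to the spectrum.* A zero of `φ(·, 0)` is an eigenvalue of `H₋`. Where
`φ(z, 0) ≠ 0`, a solution of `(H₋ - z) f = g` for finitely supported `g` is obtained from
a solution vanishing near `-∞` by subtracting a multiple of `φ(z, ·)`. Its coordinates are
holomorphic in `z`, so the maximum principle bounds it at real points as well
(`exists_bounded_preimage`), and `z` is in the resolvent set. The spectrum is thus the zero set of
`φ(·, 0)` (`spec_eq_zeros`), and the number of zeros in a disc is controlled by the growth
(`exists_card_zeros_le`).

*From the spectrum to a solution.* Let `α` be the canonical product over the spectrum
(`exists_entire_of_zeros`) and `m(z)` the Weyl function, the value at `-1` of `(H₋ - z)⁻¹ δ₋₁`.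
By the maximum principle `m` has at most simple poles, so `α m` extends to an entire function, and
its growth order is at most that of `α`. The solution with `φ(z, 0) = α(z)` and
`φ(z, -1) = -a(-1) α(z) m(z)` is a multiple of `(H₋ - z)⁻¹ δ₋₁` or of an eigenvector on the half
line. It does not vanish at an eigenvalue because `m` really has a pole there
(`norm_sq_le_weyl`).
-/

namespace Jacobi

/-! ### Solutions of the difference equation -/

theorem tau_apply (a b : ℤ → ℝ) (f : ℤ → ℂ) (n : ℤ) :
    tau a b f n = (a n : ℂ) * f (n + 1) + (a (n - 1) : ℂ) * f (n - 1) + (b n : ℂ) * f n := rfl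

theorem wronskian_apply (a : ℤ → ℝ) (f g : ℤ → ℂ) (n : ℤ) :
    wronskian a f g n = (a n : ℂ) * (f n * g (n + 1) - f (n + 1) * g n) := rfl

/-- Downward induction with two predecessors. -/
theorem int_induction_down {P : ℤ → Prop} {N : ℤ} (h0 : P N) (h1 : P (N + 1))
    (down : ∀ n < N, P (n + 1) → P (n + 2) → P n) : ∀ n ≤ N + 1, P n := by
  have key : ∀ k : ℕ, P (N - k) ∧ P (N - k + 1) := by
    intro k
    induction k with
    | zero => simpa using ⟨h0, h1⟩
    | succ k ih =>
      have e1 : N - ((k + 1 : ℕ) : ℤ) + 1 = N - k := by push_cast; ring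
      have e2 : N - ((k + 1 : ℕ) : ℤ) + 2 = N - k + 1 := by push_cast; ring
      refine ⟨down _ (by push_cast; omega) ?_ ?_, ?_⟩
      · rw [e1]; exact ih.1
      · rw [e2]; exact ih.2
      · rw [e1]; exact ih.1
  intro n hn
  rcases hn.eq_or_lt with rfl | h
  · exact h1
  · have := (key (N - n).toNat).1
    rwa [Int.toNat_of_nonneg (by omega), sub_sub_cancel] at this

/-- Two-sided induction with two predecessors. -/
theorem int_induction_two_sided {P : ℤ → Prop} {N : ℤ} (h0 : P N) (h1 : P (N + 1))
    (up : ∀ n, P n → P (n + 1) → P (n + 2)) (down : ∀ n, P (n + 1) → P (n + 2) → P n) :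
    ∀ n, P n := by
  have key : ∀ k : ℕ, P (N + k) ∧ P (N + k + 1) := by
    intro k
    induction k with
    | zero => simpa using ⟨h0, h1⟩
    | succ k ih =>
      have e1 : N + ((k + 1 : ℕ) : ℤ) + 1 = N + k + 2 := by push_cast; ring
      have e2 : N + ((k + 1 : ℕ) : ℤ) = N + k + 1 := by push_cast; ring
      refine ⟨?_, ?_⟩
      · rw [e2]; exact ih.2
      · rw [e1]; exact up _ ih.1 ih.2
  intro n
  rcases le_total n (N + 1) with h | h
  · exact int_induction_down h0 h1 (fun n _ => down n) n h
  · have := (key (n - N).toNat).1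
    rwa [Int.toNat_of_nonneg (by omega), add_sub_cancel] at this

section Recurrence

variable {a b : ℤ → ℝ} (ha : ∀ n, 0 < a n)
include ha

theorem coe_ne_zero (n : ℤ) : (a n : ℂ) ≠ 0 := by
  exact_mod_cast (ha n).ne'

theorem eq_up {f : ℤ → ℂ} {z : ℂ} {n : ℤ} (h : tau a b f (n + 1) = z * f (n + 1)) :
    f (n + 2) = ((z - b (n + 1)) * f (n + 1) - a n * f n) / a (n + 1) := by
  have e1 : n + 1 + 1 = n + 2 := by ring
  rw [tau_apply, e1, add_sub_cancel_right] at h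
  rw [eq_div_iff (coe_ne_zero ha _)]
  linear_combination h

theorem eq_down {f : ℤ → ℂ} {z : ℂ} {n : ℤ} (h : tau a b f (n + 1) = z * f (n + 1)) :
    f n = ((z - b (n + 1)) * f (n + 1) - a (n + 1) * f (n + 2)) / a n := by
  have e1 : n + 1 + 1 = n + 2 := by ring
  rw [tau_apply, e1, add_sub_cancel_right] at h
  rw [eq_div_iff (coe_ne_zero ha _)]
  linear_combination h

/-- A solution on a left half line that vanishes at the two rightmost points vanishes on the
half line. -/
theorem eq_zero_of_solution_left {f : ℤ → ℂ} {z : ℂ} {N : ℤ}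
    (h : ∀ n ≤ N, tau a b f n = z * f n) (h0 : f N = 0) (h1 : f (N + 1) = 0) :
    ∀ n ≤ N + 1, f n = 0 := by
  refine int_induction_down h0 h1 fun n hn e1 e2 => ?_
  rw [eq_down ha (h (n + 1) (by omega)), e1, e2]
  simp

theorem eq_zero_of_solution {f : ℤ → ℂ} {z : ℂ} {N : ℤ}
    (h : tau a b f = z • f) (h0 : f N = 0) (h1 : f (N + 1) = 0) : f = 0 := by
  have h' : ∀ n, tau a b f n = z * f n := fun n => congrFun h n
  funext n
  refine int_induction_two_sided (P := fun n => f n = 0) h0 h1 ?_ ?_ n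
  · intro n e0 e1
    rw [eq_up ha (h' (n + 1)), e0, e1]; simp
  · intro n e1 e2
    rw [eq_down ha (h' (n + 1)), e1, e2]; simp

/-- A property of functions of `z` that is stable under the recurrence passes from two
neighbouring values of a family of solutions to all its values. -/
theorem forall_of_recurrence {Φ : ℂ → ℤ → ℂ} (hΦ : ∀ z, tau a b (Φ z) = z • Φ z)
    {Q : (ℂ → ℂ) → Prop}
    (hQ : ∀ f g, Q f → Q g → ∀ c d e : ℝ, Q fun z => ((z - c) * f z - d * g z) / e)
    {N : ℤ} (h0 : Q fun z => Φ z N) (h1 : Q fun z => Φ z (N + 1)) :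
    ∀ n, Q fun z => Φ z n := by
  have h' : ∀ z n, tau a b (Φ z) n = z * Φ z n := fun z n => congrFun (hΦ z) n
  refine int_induction_two_sided (P := fun n => Q fun z => Φ z n) h0 h1 ?_ ?_
  · intro n e0 e1
    convert! hQ _ _ e1 e0 (b (n + 1)) (a n) (a (n + 1)) using 2 with z
    exact eq_up ha (h' z (n + 1))
  · intro n e1 e2
    convert! hQ _ _ e1 e2 (b (n + 1)) (a (n + 1)) (a n) using 2 with z
    exact eq_down ha (h' z (n + 1))

theorem exists_solution (z : ℂ) (N : ℤ) (x y : ℂ) :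
    ∃ f : ℤ → ℂ, tau a b f = z • f ∧ f N = x ∧ f (N + 1) = y := by
  -- `g k = (f (N + k), f (N + k + 1))` and `h k = (f (N - k), f (N - k + 1))`.
  let g : ℕ → ℂ × ℂ := fun k => Nat.rec (x, y)
    (fun k p => (p.2, ((z - b (N + k + 1)) * p.2 - a (N + k) * p.1) / a (N + k + 1))) k
  let h : ℕ → ℂ × ℂ := fun k => Nat.rec (x, y)
    (fun k p => (((z - b (N - k)) * p.1 - a (N - k) * p.2) / a (N - k - 1), p.1)) k
  have g1 : ∀ k, (g (k + 1)).1 = (g k).2 := fun k => rfl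
  have g2 : ∀ k, (g (k + 1)).2 =
    ((z - b (N + k + 1)) * (g k).2 - a (N + k) * (g k).1) / a (N + k + 1) := fun k => rfl
  have h2 : ∀ k, (h (k + 1)).2 = (h k).1 := fun k => rfl
  have h1 : ∀ k, (h (k + 1)).1 =
    ((z - b (N - k)) * (h k).1 - a (N - k) * (h k).2) / a (N - k - 1) := fun k => rfl
  let f : ℤ → ℂ := fun n => if N ≤ n then (g (n - N).toNat).1 else (h (N - n).toNat).1
  have fg : ∀ k : ℕ, f (N + k) = (g k).1 := by
    intro k
    have : (N + (k : ℤ) - N).toNat = k := by omega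
    simp only [f, this]
    rw [if_pos (by omega)]
  have fh : ∀ k : ℕ, f (N - k) = (h k).1 := by
    intro k
    rcases Nat.eq_zero_or_pos k with rfl | hk
    · have : f N = x := by simpa [g] using fg 0
      simpa [h] using this
    · have : (N - (N - (k : ℤ))).toNat = k := by omega
      simp only [f, this]
      rw [if_neg (by omega)]
  have f0 : f N = x := by simpa [g] using fg 0
  have f1 : f (N + 1) = y := by simpa [g] using fg 1
  refine ⟨f, ?_, f0, f1⟩
  funext n
  rw [tau_apply, Pi.smul_apply, smul_eq_mul]
  rcases lt_or_ge N n with hn | hn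
  · obtain ⟨k, rfl⟩ : ∃ k : ℕ, n = N + (k + 1 : ℕ) := ⟨(n - N - 1).toNat, by omega⟩
    have e1 : N + ((k + 1 : ℕ) : ℤ) + 1 = N + (k + 2 : ℕ) := by push_cast; ring
    have e2 : N + ((k + 1 : ℕ) : ℤ) - 1 = N + k := by push_cast; ring
    rw [e1, e2, fg, fg, fg, g1 (k + 1), g2, g1]
    have e3 : N + ((k + 1 : ℕ) : ℤ) = N + k + 1 := by push_cast; ring
    rw [e3]
    rw [mul_div_cancel₀ _ (coe_ne_zero ha _)]
    ring
  · obtain ⟨k, rfl⟩ : ∃ k : ℕ, n = N - k := ⟨(N - n).toNat, by omega⟩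
    have e2 : N - (k : ℤ) - 1 = N - (k + 1 : ℕ) := by push_cast; ring
    have e3 : f (N - k + 1) = (h k).2 := by
      rcases k with _ | k
      · simpa [h] using f1
      · rw [h2, ← fh]
        congr 1
        push_cast; ring
    have := h1 k
    rw [e2] at this
    rw [e2, fh, fh, e3, this, mul_div_cancel₀ _ (coe_ne_zero ha _)]
    ring

end Recurrence

theorem tau_star (a b : ℤ → ℝ) (f : ℤ → ℂ) : tau a b (star f) = star (tau a b f) := by
  funext n
  simp [tau_apply]

/-! ### Green's formula on the negative half line -/

/-- Pointwise Lagrange identity. -/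
theorem mul_tau_sub (a b : ℤ → ℝ) (f g : ℤ → ℂ) (n : ℤ) :
    f n * tau a b g n - tau a b f n * g n = wronskian a f g n - wronskian a f g (n - 1) := by
  simp only [tau_apply, wronskian_apply, sub_add_cancel]
  ring

/-- Indexing of the negative integers by `k ↦ -1 - k`. -/
def negEquiv : ℕ ≃ {n : ℤ // n < 0} where
  toFun k := ⟨-1 - k, by omega⟩
  invFun n := (-1 - (n : ℤ)).toNat
  left_inv k := by simp
  right_inv n := by
    obtain ⟨n, hn⟩ := n
    ext
    simp only
    omega

theorem tendsto_atBot_iff_nat {α : Type*} {F : ℤ → α} {l : Filter α} :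
    Tendsto F atBot l ↔ Tendsto (fun k : ℕ => F (-1 - k)) atTop l := by
  have h1 : Tendsto (fun k : ℕ => -1 - (k : ℤ)) atTop atBot := by
    refine tendsto_atBot.2 fun c => ?_
    filter_upwards [eventually_ge_atTop (-c).toNat] with k hk
    omega
  refine ⟨fun h => h.comp h1, fun h => ?_⟩
  have h2 : Tendsto (fun n : ℤ => (-1 - n).toNat) atBot atTop := by
    refine tendsto_atTop.2 fun c => ?_
    filter_upwards [eventually_le_atBot (-1 - (c : ℤ))] with n hn
    omega
  refine (h.comp h2).congr' ?_
  filter_upwards [eventually_le_atBot (-1 : ℤ)] with n hn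
  simp only [Function.comp]
  congr 1
  omega

theorem sum_mul_tau_sub (a b : ℤ → ℝ) (f g : ℤ → ℂ) (K : ℕ) :
    ∑ k ∈ Finset.range K, (f (-1 - k) * tau a b g (-1 - k) - tau a b f (-1 - k) * g (-1 - k)) =
      wronskian a f g (-1) - wronskian a f g (-1 - K) := by
  induction K with
  | zero => simp
  | succ K ih =>
    rw [Finset.sum_range_succ, ih, mul_tau_sub]
    push_cast
    rw [sub_sub (-1 : ℤ)]
    ring

/-- Green's formula: the Wronskian has a limit at `-∞`, given by the boundary value at `-1` and
the sum of the Lagrange expressions. -/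
theorem tendsto_wronskian {a b : ℤ → ℝ} {f g : ℤ → ℂ}
    (h : Summable fun n : {n : ℤ // n < 0} => f n * tau a b g n - tau a b f n * g n) :
    Tendsto (wronskian a f g) atBot (𝓝 (wronskian a f g (-1) -
      ∑' n : {n : ℤ // n < 0}, (f n * tau a b g n - tau a b f n * g n))) := by
  rw [tendsto_atBot_iff_nat]
  have h1 := (negEquiv.hasSum_iff.2 h.hasSum).tendsto_sum_nat
  have h2 := (tendsto_const_nhds (x := wronskian a f g (-1))).sub h1
  refine h2.congr fun K => ?_
  have := sum_mul_tau_sub a b f g K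
  simp only [Function.comp_apply, negEquiv, Equiv.coe_fn_mk]
  rw [this]
  ring

/-! ### Restriction to the negative half line -/

/-- Restriction of a sequence to the negative integers. -/
def restrNeg : (ℤ → ℂ) →ₗ[ℂ] ({n : ℤ // n < 0} → ℂ) where
  toFun f n := f n
  map_add' _ _ := rfl
  map_smul' _ _ := rfl

@[simp] theorem restrNeg_apply (f : ℤ → ℂ) (n : {n : ℤ // n < 0}) : restrNeg f n = f n := rfl

theorem extendNeg_apply (f : {n : ℤ // n < 0} → ℂ) (n : {n : ℤ // n < 0}) :
    extendNeg f n = f n := by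
  have : (n : ℤ) < 0 := n.2
  simp [extendNeg, this]

theorem extendNeg_of_lt (f : {n : ℤ // n < 0} → ℂ) {n : ℤ} (hn : n < 0) :
    extendNeg f n = f ⟨n, hn⟩ := by
  simp [extendNeg, hn]

theorem extendNeg_of_nonneg (f : {n : ℤ // n < 0} → ℂ) {n : ℤ} (hn : 0 ≤ n) :
    extendNeg f n = 0 := by
  simp [extendNeg, hn]

@[simp] theorem extendNeg_zero_apply (f : {n : ℤ // n < 0} → ℂ) : extendNeg f 0 = 0 :=
  extendNeg_of_nonneg f le_rfl

@[simp] theorem restrNeg_extendNeg (f : {n : ℤ // n < 0} → ℂ) : restrNeg (extendNeg f) = f := by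
  funext n
  exact extendNeg_apply f n

theorem tauNeg_eq (a b : ℤ → ℝ) (f : {n : ℤ // n < 0} → ℂ) :
    tauNeg a b f = restrNeg (tau a b (extendNeg f)) := rfl

theorem extendNeg_restrNeg_eventuallyEq (f : ℤ → ℂ) : extendNeg (restrNeg f) =ᶠ[atBot] f := by
  filter_upwards [eventually_lt_atBot (0 : ℤ)] with n hn
  rw [extendNeg_of_lt _ hn, restrNeg_apply]

theorem tauNeg_restrNeg (a b : ℤ → ℝ) {f : ℤ → ℂ} (h0 : f 0 = 0) :
    tauNeg a b (restrNeg f) = restrNeg (tau a b f) := by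
  have key : ∀ n ≤ (0 : ℤ), extendNeg (restrNeg f) n = f n := by
    intro n hn
    rcases hn.lt_or_eq with h | rfl
    · rw [extendNeg_of_lt _ h, restrNeg_apply]
    · rw [extendNeg_zero_apply, h0]
  funext n
  have hn : (n : ℤ) < 0 := n.2
  rw [tauNeg_eq, restrNeg_apply, restrNeg_apply, tau_apply, tau_apply, key _ (by omega),
    key _ (by omega), key _ (by omega)]

theorem tau_congr {a b : ℤ → ℝ} {f g : ℤ → ℂ} (h : f =ᶠ[atBot] g) :
    tau a b f =ᶠ[atBot] tau a b g := by
  obtain ⟨N, hN⟩ := eventually_atBot.1 h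
  filter_upwards [eventually_le_atBot (N - 1)] with n hn
  rw [tau_apply, tau_apply, hN _ (by omega), hN _ (by omega), hN _ (by omega)]

theorem wronskian_congr {a : ℤ → ℝ} {u f g : ℤ → ℂ} (h : f =ᶠ[atBot] g) :
    wronskian a u f =ᶠ[atBot] wronskian a u g := by
  obtain ⟨N, hN⟩ := eventually_atBot.1 h
  filter_upwards [eventually_le_atBot (N - 1)] with n hn
  rw [wronskian_apply, wronskian_apply, hN _ (by omega), hN _ (by omega)]

theorem memlp_two_iff {ι : Type*} {f : ι → ℂ} : Memℓp f 2 ↔ Summable fun i => ‖f i‖ ^ 2 := by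
  rw [memℓp_gen_iff (by norm_num)]
  norm_num

theorem eventually_cofinite_neg {P : ℤ → Prop} (h : ∀ᶠ n in atBot, P n) :
    ∀ᶠ n : {n : ℤ // n < 0} in cofinite, P n := by
  obtain ⟨N, hN⟩ := eventually_atBot.1 h
  have hf : (Set.Icc N 0).Finite := Set.finite_Icc N 0
  have : {n : {n : ℤ // n < 0} | ¬ P n} ⊆ Subtype.val ⁻¹' (Set.Icc N 0) := by
    intro n hn
    have h1 : (n : ℤ) < 0 := n.2
    refine ⟨?_, h1.le⟩
    by_contra hc
    exact hn (hN _ (by omega))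
  exact (hf.preimage Subtype.val_injective.injOn).subset this

/-- Square summability near `-∞` depends only on the values near `-∞`. -/
theorem memlp_restrNeg_congr {f g : ℤ → ℂ} (h : f =ᶠ[atBot] g) (hf : Memℓp (restrNeg f) 2) :
    Memℓp (restrNeg g) 2 := by
  rw [memlp_two_iff] at *
  refine (summable_congr_cofinite ?_).1 hf
  filter_upwards [eventually_cofinite_neg h] with n hn
  rw [restrNeg_apply, restrNeg_apply, hn]

theorem memlp_restrNeg_of_sqSummableNear {f : ℤ → ℂ} (h : SqSummableNear atBot f) :
    Memℓp (restrNeg f) 2 := by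
  obtain ⟨s, hs, hf⟩ := h
  rw [memlp_two_iff]
  have h1 : Summable (s.indicator fun n => ‖f n‖ ^ 2) := summable_subtype_iff_indicator.1 hf
  have h2 : Summable fun n : {n : ℤ // n < 0} => s.indicator (fun n => ‖f n‖ ^ 2) n :=
    h1.comp_injective Subtype.val_injective
  refine (summable_congr_cofinite ?_).1 h2
  filter_upwards [eventually_cofinite_neg (P := fun n => n ∈ s) hs] with n hn
  rw [Set.indicator_of_mem hn, restrNeg_apply]

theorem summable_mul_of_memlp {ι : Type*} {f g : ι → ℂ} (hf : Memℓp f 2) (hg : Memℓp g 2) :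
    Summable fun i => f i * g i := by
  rw [memlp_two_iff] at *
  refine Summable.of_norm_bounded (hf.add hg) fun i => ?_
  rw [norm_mul]
  nlinarith [sq_nonneg (‖f i‖ - ‖g i‖), sq_nonneg (‖f i‖ + ‖g i‖)]

theorem memlp_star {ι : Type*} {f : ι → ℂ} (hf : Memℓp f 2) : Memℓp (star f) 2 := by
  rw [memlp_two_iff] at *
  simpa using hf

/-! ### Symmetric and closed operators -/

section Abstract

variable {E : Type*} [NormedAddCommGroup E]

section InnerProduct

variable [InnerProductSpace ℂ E]

/-- The lower bound `|Im z| ‖f‖ ≤ ‖T f - z f‖` for symmetric `T`, stated for a single vector `f`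
with image `g`. -/
theorem abs_im_mul_norm_le {f g : E} (h : (inner ℂ f g : ℂ).im = 0) (z : ℂ) :
    |z.im| * ‖f‖ ≤ ‖g - z • f‖ := by
  have h1 : (inner ℂ f (g - z • f) : ℂ).im = -(z.im * ‖f‖ ^ 2) := by
    rw [inner_sub_right, inner_smul_right, inner_self_eq_norm_sq_to_K, Complex.sub_im, h]
    simp [← Complex.ofReal_pow]
  have h2 : |(inner ℂ f (g - z • f) : ℂ).im| ≤ ‖f‖ * ‖g - z • f‖ :=
    (Complex.abs_im_le_norm _).trans (norm_inner_le_norm _ _)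
  rw [h1, abs_neg, abs_mul, abs_of_nonneg (sq_nonneg ‖f‖)] at h2
  rcases (norm_nonneg f).eq_or_lt with h0 | h0
  · rw [← h0, mul_zero]; exact norm_nonneg _
  · exact le_of_mul_le_mul_left (by nlinarith) h0

theorem im_inner_self_eq_zero {T : E →ₗ.[ℂ] E} (hT : T.IsFormalAdjoint T) (f : T.domain) :
    (inner ℂ (f : E) (T f) : ℂ).im = 0 := by
  have h := hT f f
  rw [← inner_conj_symm] at h
  exact Complex.conj_eq_iff_im.1 h

theorem im_inner_resolvent {T : E →ₗ.[ℂ] E} (hT : T.IsFormalAdjoint T) (f : T.domain) (z : ℂ) :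
    (inner ℂ (T f - z • (f : E)) (f : E) : ℂ).im = z.im * ‖(f : E)‖ ^ 2 := by
  rw [inner_sub_left, inner_smul_left, inner_self_eq_norm_sq_to_K, Complex.sub_im, hT f f,
    im_inner_self_eq_zero hT]
  simp [← Complex.ofReal_pow]

theorem im_eq_zero_of_eigenvalue {T : E →ₗ.[ℂ] E} (hT : T.IsFormalAdjoint T) {f : T.domain}
    {z : ℂ} (h : T f = z • (f : E)) (hf : (f : E) ≠ 0) : z.im = 0 := by
  have h1 := abs_im_mul_norm_le (im_inner_self_eq_zero hT f) z
  rw [h, sub_self, norm_zero] at h1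
  have h2 : 0 < ‖(f : E)‖ := norm_pos_iff.2 hf
  by_contra hz
  have := mul_pos (abs_pos.2 hz) h2
  linarith

end InnerProduct

variable [NormedSpace ℂ E]

/-- Let `T` be closed, `T - z` injective, and suppose that `(T - z) f = g` has a solution in `D`
with `‖f‖ ≤ C ‖g‖` for all `g` in a dense subspace. Then it has a solution `f` with the same bound
for every `g`, and `f` is a limit, in the graph norm, of elements of `D`. -/
theorem exists_approx [CompleteSpace E] {T : E →ₗ.[ℂ] E} (hT : T.IsClosed) {z : ℂ} {C : ℝ}
    {S : Submodule ℂ E} (hS : Dense (S : Set E)) {D : Set T.domain}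
    (hD : ∀ g ∈ S, ∃ f ∈ D, T f - z • (f : E) = g ∧ ‖(f : E)‖ ≤ C * ‖g‖)
    (inj : ∀ f : T.domain, T f = z • (f : E) → f = 0) (g : E) :
    ∃ (f : T.domain) (F : ℕ → T.domain), (∀ k, F k ∈ D) ∧
      Tendsto (fun k => (F k : E)) atTop (𝓝 f) ∧ Tendsto (fun k => T (F k)) atTop (𝓝 (T f)) ∧
      T f - z • (f : E) = g ∧ ‖(f : E)‖ ≤ C * ‖g‖ := by
  obtain ⟨G, hG, hGg⟩ := mem_closure_iff_seq_limit.1 (hS g)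
  choose F hFD hFG hFC using fun k => hD (G k) (hG k)
  have hsub : ∀ k l, ‖(F k : E) - F l‖ ≤ C * ‖G k - G l‖ := by
    intro k l
    obtain ⟨f, -, hf, hfC⟩ := hD _ (S.sub_mem (hG k) (hG l))
    have : f - (F k - F l) = 0 := by
      apply inj
      rw [LinearPMap.map_sub, LinearPMap.map_sub, sub_eq_iff_eq_add.1 hf, ← hFG k, ← hFG l]
      simp only [Submodule.coe_sub, smul_sub]
      abel
    rw [sub_eq_zero] at this
    rw [this] at hfC
    exact_mod_cast hfC
  have hcau : CauchySeq fun k => (F k : E) := by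
    have hGc := hGg.cauchySeq
    rw [Metric.cauchySeq_iff] at hGc ⊢
    intro ε hε
    obtain ⟨N, hN⟩ := hGc (ε / (|C| + 1)) (by positivity)
    refine ⟨N, fun m hm n hn => ?_⟩
    have h1 := hN m hm n hn
    rw [dist_eq_norm, lt_div_iff₀ (by positivity)] at h1
    rw [dist_eq_norm]
    refine (hsub m n).trans_lt (lt_of_le_of_lt ?_ h1)
    nlinarith [norm_nonneg (G m - G n), le_abs_self C]
  obtain ⟨x, hx⟩ := cauchySeq_tendsto_of_complete hcau
  have hTF : Tendsto (fun k => T (F k)) atTop (𝓝 (g + z • x)) := by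
    refine (hGg.add (hx.const_smul z)).congr fun k => ?_
    rw [← hFG k, sub_add_cancel]
  have hmem : (x, g + z • x) ∈ T.graph := by
    refine _root_.IsClosed.mem_of_tendsto hT (hx.prodMk_nhds hTF) (Eventually.of_forall fun k => ?_)
    exact T.mem_graph (F k)
  obtain ⟨f, hfx, hfg⟩ := T.mem_graph_iff.1 hmem
  simp only at hfx hfg
  refine ⟨f, F, hFD, by rwa [hfx], by rwa [hfg], by rw [hfg, hfx, add_sub_cancel_right], ?_⟩
  rw [hfx]
  exact le_of_tendsto_of_tendsto' hx.norm ((hGg.norm).const_mul C) hFC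

/-- If `T - z` is injective and each `g` has a preimage bounded by `C ‖g‖`, then `z` is in the
resolvent set. -/
theorem isResolventPoint_of_bound {T : E →ₗ.[ℂ] E} {z : ℂ} {C : ℝ}
    (h : ∀ g, ∃ f : T.domain, T f - z • (f : E) = g ∧ ‖(f : E)‖ ≤ C * ‖g‖)
    (inj : ∀ f : T.domain, T f = z • (f : E) → f = 0) : IsResolventPoint T z := by
  choose R hR hRC using h
  have uniq : ∀ f f' : T.domain, T f - z • (f : E) = T f' - z • (f' : E) → f = f' := by
    intro f f' hff
    rw [← sub_eq_zero]
    apply inj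
    rw [LinearPMap.map_sub, Submodule.coe_sub, smul_sub, ← sub_eq_zero]
    rw [← sub_eq_zero] at hff
    rw [← hff]
    abel
  let R' : E →ₗ[ℂ] E :=
    { toFun := fun g => R g
      map_add' := fun g g' => by
        rw [← Submodule.coe_add]
        congr 1
        apply uniq
        rw [hR, LinearPMap.map_add, Submodule.coe_add, smul_add, add_sub_add_comm, hR, hR]
      map_smul' := fun c g => by
        rw [RingHom.id_apply, ← Submodule.coe_smul]
        congr 1
        apply uniq
        rw [hR, T.map_smul, Submodule.coe_smul, smul_comm z c, ← smul_sub, hR] }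
  refine ⟨R'.mkContinuous C hRC, fun g => ⟨(R g).2, hR g⟩, fun f => ?_⟩
  change (R (T f - z • (f : E)) : E) = f
  congr 1
  exact uniq _ _ (hR _)

theorem not_isResolventPoint_of_eigenvalue {T : E →ₗ.[ℂ] E} {z : ℂ} {f : T.domain}
    (h : T f = z • (f : E)) (hf : (f : E) ≠ 0) : ¬ IsResolventPoint T z := by
  rintro ⟨R, -, hR⟩
  have := hR f
  rw [h, sub_self, map_zero] at this
  exact hf this.symm

theorem mem_eigenspace_iff {T : E →ₗ.[ℂ] E} {z : ℂ} {f : T.domain} :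
    f ∈ eigenspace T z ↔ T f = z • (f : E) := by
  rw [eigenspace, LinearMap.mem_ker, LinearMap.sub_apply, sub_eq_zero]
  rfl

end Abstract

/-! ### A maximum principle for functions bounded by `1 / |Im z|` -/

theorem norm_sq_sub_sq {x r : ℝ} {w : ℂ} (hw : ‖w - x‖ = r) :
    ‖(w - x) ^ 2 - (r : ℂ) ^ 2‖ = 2 * r * |w.im| := by
  have h0 : (w.re - x) ^ 2 + w.im ^ 2 = r ^ 2 := by
    rw [← hw, Complex.sq_norm, Complex.normSq_apply]
    simp
    ring
  have h1 : (w - x) ^ 2 - (r : ℂ) ^ 2 = 2 * w.im * Complex.I * (w - x) := by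
    have : (r : ℂ) ^ 2 = ((w.re - x) ^ 2 + w.im ^ 2 : ℝ) := by rw [h0]; push_cast; ring
    rw [this]
    conv_lhs => rw [← Complex.re_add_im w]
    conv_rhs => rw [← Complex.re_add_im w]
    push_cast
    ring_nf
    simp only [Complex.I_sq]
    simp
    ring
  rw [h1, norm_mul, hw]
  simp
  ring

/-- If `F` is holomorphic on a disc with real centre and `|F(w)| |Im w| ≤ M` on its boundary
circle, then `F` is bounded by `3 M / r` on the concentric disc of half the radius. The
factor `(w - x)² - r²` has modulus `2 r |Im w|` on the circle, which offsets the possible growth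
of `F` near the real axis. -/
theorem norm_le_of_norm_mul_im_le {F : ℂ → ℂ} {x r M : ℝ} (hr : 0 < r)
    (hF : DifferentiableOn ℂ F (Metric.closedBall x r))
    (hM : ∀ w : ℂ, ‖w - x‖ = r → ‖F w‖ * |w.im| ≤ M) {z : ℂ} (hz : ‖z - x‖ ≤ r / 2) :
    ‖F z‖ ≤ 3 * M / r := by
  let g : ℂ → ℂ := fun w => F w * ((w - x) ^ 2 - (r : ℂ) ^ 2)
  have hg : DifferentiableOn ℂ g (Metric.closedBall x r) := by
    refine hF.mul (Differentiable.differentiableOn ?_)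
    fun_prop
  have hgc : DiffContOnCl ℂ g (Metric.ball (x : ℂ) r) := by
    refine DifferentiableOn.diffContOnCl ?_
    rwa [closure_ball _ hr.ne']
  have hfr : ∀ w ∈ frontier (Metric.ball (x : ℂ) r), ‖g w‖ ≤ 2 * r * M := by
    intro w hw
    rw [frontier_ball _ hr.ne', mem_sphere_iff_norm] at hw
    rw [norm_mul, norm_sq_sub_sq hw]
    nlinarith [hM w hw]
  have hzc : z ∈ closure (Metric.ball (x : ℂ) r) := by
    rw [closure_ball _ hr.ne', mem_closedBall_iff_norm]
    linarith
  have h1 := Complex.norm_le_of_forall_mem_frontier_norm_le Metric.isBounded_ball hgc hfr hzc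
  rw [norm_mul] at h1
  have h2 : 3 / 4 * r ^ 2 ≤ ‖(z - x) ^ 2 - (r : ℂ) ^ 2‖ := by
    have := norm_sub_norm_le ((r : ℂ) ^ 2) ((z - x) ^ 2)
    rw [norm_sub_rev, norm_pow, norm_pow, Complex.norm_real, Real.norm_of_nonneg hr.le] at this
    nlinarith [norm_nonneg (z - x)]
  have h3 : ‖F z‖ * (3 / 4 * r ^ 2) ≤ 2 * r * M :=
    (mul_le_mul_of_nonneg_left h2 (norm_nonneg _)).trans h1
  have h4 : ‖F z‖ * (3 / 4 * r) ≤ 2 * M := by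
    refine le_of_mul_le_mul_left ?_ hr
    nlinarith
  rw [le_div_iff₀ hr]
  have : 0 ≤ ‖F z‖ * r := by positivity
  nlinarith

/-! ### The domain of the half-line operator -/

/-- The sequences that lie in the domain of `H₋` near `-∞`. -/
def nearDomain (a b : ℤ → ℝ) (u : ℤ → ℂ) : Submodule ℂ (ℤ → ℂ) where
  carrier := {f | Memℓp (restrNeg f) 2 ∧ Memℓp (restrNeg (tau a b f)) 2 ∧
    Tendsto (wronskian a u f) atBot (𝓝 0)}
  add_mem' := by
    rintro f g ⟨hf, hf1, hf2⟩ ⟨hg, hg1, hg2⟩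
    refine ⟨?_, ?_, ?_⟩
    · rw [map_add]; exact hf.add hg
    · rw [map_add, map_add]; exact hf1.add hg1
    · rw [map_add]; exact tendsto_add_zero hf2 hg2
  zero_mem' := by
    refine ⟨?_, ?_, ?_⟩
    · rw [map_zero]; exact zero_memℓp
    · rw [map_zero, map_zero]; exact zero_memℓp
    · rw [map_zero]; exact tendsto_const_nhds
  smul_mem' := by
    rintro c f ⟨hf, hf1, hf2⟩
    refine ⟨?_, ?_, ?_⟩
    · rw [map_smul]; exact hf.const_smul c
    · rw [map_smul, map_smul]; exact hf1.const_smul c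
    · rw [map_smul]; exact tendsto_smul_zero c hf2

theorem mem_nearDomain_congr {a b : ℤ → ℝ} {u f g : ℤ → ℂ} (h : f =ᶠ[atBot] g)
    (hf : f ∈ nearDomain a b u) : g ∈ nearDomain a b u :=
  ⟨memlp_restrNeg_congr h hf.1, memlp_restrNeg_congr (tau_congr h) hf.2.1,
    hf.2.2.congr' (wronskian_congr h)⟩

/-- A sequence in `nearDomain` that vanishes at `0` restricts to an element of the domain
of `H₋`. -/
theorem exists_domain_of_mem_nearDomain {a b : ℤ → ℝ} {u F : ℤ → ℂ}
    (hF : F ∈ nearDomain a b u) (h0 : F 0 = 0) :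
    ∃ f : (opHminus a b u).domain, ((f : L2Neg) : {n : ℤ // n < 0} → ℂ) = restrNeg F ∧
      (opHminus a b u f : {n : ℤ // n < 0} → ℂ) = restrNeg (tau a b F) := by
  refine ⟨⟨⟨restrNeg F, hF.1⟩, ?_, ?_⟩, rfl, ?_⟩
  · change Memℓp (tauNeg a b (restrNeg F)) 2
    rw [tauNeg_restrNeg a b h0]
    exact hF.2.1
  · exact hF.2.2.congr' (wronskian_congr (extendNeg_restrNeg_eventuallyEq F).symm)
  · exact tauNeg_restrNeg a b h0

theorem extendNeg_mem_nearDomain {a b : ℤ → ℝ} {u : ℤ → ℂ} (f : (opHminus a b u).domain) :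
    extendNeg (f : L2Neg) ∈ nearDomain a b u := by
  refine ⟨?_, f.2.1, f.2.2⟩
  rw [restrNeg_extendNeg]
  exact lp.memℓp _

theorem opHminus_apply {a b : ℤ → ℝ} {u : ℤ → ℂ} (f : (opHminus a b u).domain)
    (n : {n : ℤ // n < 0}) :
    (opHminus a b u f : {n : ℤ // n < 0} → ℂ) n = tau a b (extendNeg (f : L2Neg)) n := rfl

theorem mem_nearDomain_of_inDomainNearBot {a b : ℤ → ℝ} {u v f : ℤ → ℂ}
    (h : InDomainNearBot a b u v f) : f ∈ nearDomain a b u := by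
  obtain ⟨g, ⟨hg1, hg2, -⟩, hgf⟩ := h
  refine mem_nearDomain_congr (f := g) (hgf.mono fun n hn => hn.symm) ⟨?_, ?_, hg2⟩
  · have := lp.memℓp g
    rw [memlp_two_iff] at this ⊢
    exact this.comp_injective Subtype.val_injective
  · rw [memlp_two_iff] at hg1 ⊢
    exact hg1.comp_injective Subtype.val_injective

theorem inDomainNearBot_of_domain {a b : ℤ → ℝ} {u v F : ℤ → ℂ} (f : (opHminus a b u).domain)
    (h : F =ᶠ[atBot] extendNeg (f : L2Neg)) : InDomainNearBot a b u v F := by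
  set G := extendNeg (f : L2Neg) with hG
  have hG0 : ∀ n, 0 ≤ n → G n = 0 := fun n hn => extendNeg_of_nonneg _ hn
  have hmem : ∀ g : ℤ → ℂ, Memℓp (restrNeg g) 2 → (∀ n, 1 ≤ n → g n = 0) → Memℓp g 2 := by
    intro g hg h0
    rw [memlp_two_iff] at hg ⊢
    have h1 : Summable ((Set.Iio (0 : ℤ)).indicator fun n => ‖g n‖ ^ 2) :=
      summable_subtype_iff_indicator.1 hg
    refine (summable_congr_cofinite ?_).1 h1
    have : ({0} : Set ℤ).Finite := Set.finite_singleton 0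
    filter_upwards [this.compl_mem_cofinite] with n hn
    rcases lt_or_ge n 0 with hn0 | hn0
    · rw [Set.indicator_of_mem (by simpa using hn0)]
    · rw [Set.indicator_of_notMem (by simpa using hn0), h0 n]
      · simp
      · have : n ≠ 0 := by simpa using hn
        omega
  have hGmem := extendNeg_mem_nearDomain f
  refine ⟨⟨G, hmem G hGmem.1 fun n hn => hG0 n (by omega)⟩, ⟨?_, hGmem.2.2, ?_⟩, h⟩
  · refine hmem _ hGmem.2.1 fun n hn => ?_
    change tau a b G n = 0
    rw [tau_apply, hG0 _ (by omega), hG0 _ (by omega), hG0 _ (by omega)]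
    simp
  · refine tendsto_const_nhds.congr' ?_
    filter_upwards [eventually_ge_atTop (0 : ℤ)] with n hn
    rw [wronskian_apply, hG0 _ (by omega), hG0 _ (by omega)]
    simp

/-- An eigenfunction of `H₋` that vanishes at `-1` is zero. -/
theorem eq_zero_of_eigenvalue {a b : ℤ → ℝ} (ha : ∀ n, 0 < a n) {u : ℤ → ℂ} {z : ℂ}
    {f : (opHminus a b u).domain} (h : opHminus a b u f = z • (f : L2Neg))
    (h1 : (f : L2Neg) ⟨-1, by norm_num⟩ = 0) : f = 0 := by
  have h2 := eq_zero_of_solution_left ha (f := extendNeg (f : L2Neg)) (b := b) (z := z) (N := -1)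
    ?_ ?_ ?_
  · apply Subtype.ext
    apply lp.ext
    funext n
    have hn : (n : ℤ) < 0 := n.2
    rw [← extendNeg_apply ((f : L2Neg) : {n : ℤ // n < 0} → ℂ) n, h2 n (by omega)]
    rfl
  · intro n hn
    have e := opHminus_apply f ⟨n, by omega⟩
    rw [h] at e
    rw [← e, lp.coeFn_smul, Pi.smul_apply, smul_eq_mul, extendNeg_of_lt _ (by omega : n < 0)]
  · rw [extendNeg_of_lt _ (by norm_num)]
    exact h1
  · exact extendNeg_of_nonneg _ (by norm_num)

theorem inner_eq_tsum_mul (f g : L2Neg) :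
    inner ℂ f g = ∑' n, star ((f : {n : ℤ // n < 0} → ℂ) n) * g n := by
  rw [lp.inner_eq_tsum]
  refine tsum_congr fun n => ?_
  rw [RCLike.inner_apply, mul_comm]
  rfl

/-- The boundary form of `H₋` at `-∞`. -/
theorem tendsto_wronskian_star {a b : ℤ → ℝ} {u : ℤ → ℂ} (f g : (opHminus a b u).domain) :
    Tendsto (wronskian a (star (extendNeg (f : L2Neg))) (extendNeg (g : L2Neg))) atBot
      (𝓝 (inner ℂ (opHminus a b u f) (g : L2Neg) - inner ℂ (f : L2Neg) (opHminus a b u g))) := by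
  set F := extendNeg (f : L2Neg) with hF
  set G := extendNeg (g : L2Neg) with hG
  have h1 : Summable fun n : {n : ℤ // n < 0} => star F n * tau a b G n := by
    have := summable_mul_of_memlp (memlp_star (extendNeg_mem_nearDomain f).1) g.2.1
    exact this
  have h2 : Summable fun n : {n : ℤ // n < 0} => tau a b (star F) n * G n := by
    have := summable_mul_of_memlp (memlp_star f.2.1) (extendNeg_mem_nearDomain g).1
    rw [tau_star]
    exact this
  have h3 := tendsto_wronskian (h1.sub h2)
  rw [(h1.hasSum.sub h2.hasSum).tsum_eq] at h3
  convert! h3 using 2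
  have e0 : F 0 = 0 := extendNeg_zero_apply _
  have e1 : G 0 = 0 := extendNeg_zero_apply _
  rw [wronskian_apply, neg_add_cancel, e1, Pi.star_apply, Pi.star_apply, e0, inner_eq_tsum_mul,
    inner_eq_tsum_mul]
  have e3 : ∀ n, (g : L2Neg) n = G n := fun n => (extendNeg_apply _ n).symm
  have e4 : ∀ n, (f : L2Neg) n = F n := fun n => (extendNeg_apply _ n).symm
  simp only [e3, e4, opHminus_apply, tau_star, Pi.star_apply]
  simp [hF, hG]

/-! ### Finitely supported right-hand sides -/

/-- The subspace of finitely supported vectors. -/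
noncomputable def finSupp : Submodule ℂ L2Neg :=
  Submodule.span ℂ (Set.range fun m => lp.single 2 m (1 : ℂ))

theorem single_mem_finSupp (m : {n : ℤ // n < 0}) (c : ℂ) :
    (lp.single 2 m c : L2Neg) ∈ finSupp := by
  have : (lp.single 2 m c : L2Neg) = c • lp.single 2 m (1 : ℂ) := by
    rw [← lp.single_smul, smul_eq_mul, mul_one]
  rw [this]
  exact Submodule.smul_mem _ _ (Submodule.subset_span ⟨m, rfl⟩)

theorem dense_finSupp : Dense (finSupp : Set L2Neg) := by
  intro f
  have h := lp.hasSum_single (p := 2) (by norm_num) f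
  refine mem_closure_of_tendsto h (Eventually.of_forall fun s => ?_)
  exact Submodule.sum_mem _ fun i _ => single_mem_finSupp _ _

/-- The solutions of `(τ - z) P = δ_m` that vanish to the left of `m`; they depend on `z` as
polynomials, in particular holomorphically. -/
theorem exists_inhomogeneous {a b : ℤ → ℝ} (ha : ∀ n, 0 < a n) (m : ℤ) :
    ∃ P : ℂ → ℤ → ℂ, (∀ n, Differentiable ℂ fun z => P z n) ∧
      ∀ z, (∀ n ≤ m, P z n = 0) ∧ tau a b (P z) = z • P z + Pi.single m 1 := by
  choose Q hQ hQ0 hQ1 using fun z => exists_solution ha (b := b) z m 0 (1 / a m)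
  have hQd : ∀ n, Differentiable ℂ fun z => Q z n := by
    refine forall_of_recurrence ha hQ ?_ (N := m) ?_ ?_
    · intro f g hf hg c d e
      fun_prop
    · simp [hQ0]
    · simp [hQ1]
  refine ⟨fun z n => if n ≤ m then 0 else Q z n, fun n => ?_, fun z => ⟨fun n hn => if_pos hn, ?_⟩⟩
  · by_cases h : n ≤ m
    · simp [h]
    · simpa [h] using hQd n
  · beta_reduce
    have hPQ : ∀ n, m ≤ n → (if n ≤ m then 0 else Q z n) = Q z n := by
      intro n hn
      rcases hn.lt_or_eq with h | rfl
      · rw [if_neg (by omega)]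
      · rw [if_pos le_rfl, hQ0]
    funext n
    rw [tau_apply, Pi.add_apply, Pi.smul_apply, smul_eq_mul]
    rcases lt_trichotomy n m with h | rfl | h
    · rw [if_pos (by omega), if_pos (by omega), if_pos (by omega), Pi.single_eq_of_ne h.ne]
      simp
    · rw [if_neg (by omega), if_pos (by omega), if_pos le_rfl, hQ1, Pi.single_eq_same,
        mul_one_div_cancel (coe_ne_zero ha n)]
      simp
    · rw [hPQ _ (by omega), hPQ _ (by omega), hPQ _ (by omega), Pi.single_eq_of_ne h.ne',
        add_zero, ← tau_apply, hQ]
      rfl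

/-- If `v` is a solution in the domain near `-∞` with `v 0 ≠ 0`, then subtracting a multiple of
`v` from a solution of `(τ - z) P = δ_m` vanishing near `-∞` gives a preimage of `δ_m` under
`H₋ - z`. -/
theorem exists_preimage_single {a b : ℤ → ℝ} {u v P : ℤ → ℂ} {z : ℂ}
    (hv : tau a b v = z • v) (hvd : v ∈ nearDomain a b u) (hv0 : v 0 ≠ 0) {m : {n : ℤ // n < 0}}
    (hP0 : ∀ n ≤ (m : ℤ), P n = 0) (hP : tau a b P = z • P + Pi.single (m : ℤ) 1) :
    ∃ f : (opHminus a b u).domain,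
      (∀ n, (f : L2Neg) n = P n - P 0 / v 0 * v n) ∧
      extendNeg (f : L2Neg) =ᶠ[atBot] (-(P 0 / v 0)) • v ∧
      opHminus a b u f - z • (f : L2Neg) = lp.single 2 m (1 : ℂ) := by
  set c := P 0 / v 0 with hc
  set F : ℤ → ℂ := P - c • v with hF
  have hP' : P =ᶠ[atBot] 0 := by
    filter_upwards [eventually_le_atBot (m : ℤ)] with n hn
    exact hP0 n hn
  have hFv : F =ᶠ[atBot] (-c) • v := by
    filter_upwards [hP'] with n hn
    simp [hF, hn]
  have hFd : F ∈ nearDomain a b u :=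
    mem_nearDomain_congr hFv.symm (Submodule.smul_mem _ _ hvd)
  have hF0 : F 0 = 0 := by simp [hF, hc, hv0]
  obtain ⟨f, hf, hTf⟩ := exists_domain_of_mem_nearDomain hFd hF0
  refine ⟨f, fun n => ?_, ?_, ?_⟩
  · rw [hf]; simp [hF]
  · rw [hf]
    exact (extendNeg_restrNeg_eventuallyEq F).trans hFv
  · apply lp.ext
    funext n
    rw [lp.coeFn_sub, lp.coeFn_smul, Pi.sub_apply, Pi.smul_apply, hTf, hf, hF, map_sub, hP,
      map_smul, hv, lp.single_apply, restrNeg_apply, restrNeg_apply]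
    by_cases h : n = m
    · subst h
      simp
      ring
    · have h' : (n : ℤ) ≠ m := fun e => h (Subtype.ext e)
      simp [h, h']
      ring

theorem exists_preimage_finSupp {a b : ℤ → ℝ} (ha : ∀ n, 0 < a n) {u v : ℤ → ℂ} {z : ℂ}
    (hv : tau a b v = z • v) (hvd : v ∈ nearDomain a b u) (hv0 : v 0 ≠ 0) {g : L2Neg}
    (hg : g ∈ finSupp) :
    ∃ f : (opHminus a b u).domain, (∃ c : ℂ, extendNeg (f : L2Neg) =ᶠ[atBot] c • v) ∧
      opHminus a b u f - z • (f : L2Neg) = g := by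
  induction hg using Submodule.span_induction with
  | mem g hg =>
    obtain ⟨m, rfl⟩ := hg
    obtain ⟨P, -, hP⟩ := exists_inhomogeneous ha (b := b) m
    obtain ⟨f, -, hfv, hf⟩ := exists_preimage_single hv hvd hv0 (hP z).1 (hP z).2
    exact ⟨f, ⟨_, hfv⟩, hf⟩
  | zero =>
    refine ⟨0, ⟨0, ?_⟩, by simp⟩
    rw [Submodule.coe_zero, lp.coeFn_zero, map_zero, zero_smul]
  | add g g' _ _ h h' =>
    obtain ⟨f, ⟨c, hfc⟩, hf⟩ := h
    obtain ⟨f', ⟨c', hfc'⟩, hf'⟩ := h'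
    refine ⟨f + f', ⟨c + c', ?_⟩, ?_⟩
    · rw [Submodule.coe_add, lp.coeFn_add, map_add, add_smul]
      exact hfc.add hfc'
    · rw [LinearPMap.map_add, Submodule.coe_add, smul_add, add_sub_add_comm, hf, hf']
  | smul k g _ h =>
    obtain ⟨f, ⟨c, hfc⟩, hf⟩ := h
    refine ⟨k • f, ⟨k • c, ?_⟩, ?_⟩
    · rw [Submodule.coe_smul, lp.coeFn_smul, map_smul, smul_assoc]
      exact hfc.const_smul k
    · rw [LinearPMap.map_smul, Submodule.coe_smul, smul_comm z k, ← smul_sub, hf]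

/-! ### The half-line operator is closed and symmetric -/

section BoundarySolution

variable {a b : ℤ → ℝ} {z₀ : ℂ} {u : ℤ → ℂ}

theorem IsBoundarySolution.mem_nearDomain (hu : IsBoundarySolution a b z₀ atBot u) :
    u ∈ nearDomain a b u := by
  have h := memlp_restrNeg_of_sqSummableNear hu.sqSummable
  refine ⟨h, ?_, ?_⟩
  · rw [hu.solution, map_smul]
    exact h.const_smul z₀
  · have : wronskian a u u = 0 := by
      funext n
      simp [wronskian_apply, mul_comm]
    rw [this]
    exact tendsto_const_nhds

/-- The complex conjugate of `u` as a vector of `ℓ²` over the negative integers. -/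
def IsBoundarySolution.conjVec (hu : IsBoundarySolution a b z₀ atBot u) : L2Neg :=
  ⟨(star (restrNeg u) : {n : ℤ // n < 0} → ℂ), memlp_star hu.mem_nearDomain.1⟩

theorem IsBoundarySolution.conjVec_apply (hu : IsBoundarySolution a b z₀ atBot u)
    (n : {n : ℤ // n < 0}) : hu.conjVec n = star (u n) := rfl

theorem IsBoundarySolution.tendsto_wronskian_star_self (hu : IsBoundarySolution a b z₀ atBot u) :
    Tendsto (wronskian a (star u) u) atBot (𝓝 0) := by
  have : wronskian a (star u) u = -wronskian a u (star u) := by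
    funext n
    simp only [wronskian_apply, Pi.neg_apply, Pi.star_apply]
    ring
  rw [this, ← neg_zero]
  exact hu.selfAdjoint.neg

/-- A boundary solution does not vanish at `0`: its restriction would be an eigenfunction with
nonreal eigenvalue. -/
theorem IsBoundarySolution.apply_zero_ne_zero (ha : ∀ n, 0 < a n) (hz₀ : z₀.im ≠ 0)
    (hu : IsBoundarySolution a b z₀ atBot u) : u 0 ≠ 0 := by
  intro h0
  obtain ⟨f, hf, hTf⟩ := exists_domain_of_mem_nearDomain hu.mem_nearDomain h0
  have hT : opHminus a b u f = z₀ • (f : L2Neg) := by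
    apply lp.ext
    rw [hTf, lp.coeFn_smul, hf, hu.solution, map_smul]
  have h1 := tendsto_wronskian_star f f
  have h2 : wronskian a (star (extendNeg (f : L2Neg))) (extendNeg (f : L2Neg)) =ᶠ[atBot]
      wronskian a (star u) u := by
    obtain ⟨N, hN⟩ := eventually_atBot.1 (extendNeg_restrNeg_eventuallyEq u)
    filter_upwards [eventually_le_atBot (N - 1)] with n hn
    rw [hf, wronskian_apply, wronskian_apply, Pi.star_apply, Pi.star_apply, Pi.star_apply,
      Pi.star_apply, hN _ (by omega), hN _ (by omega)]
  have h3 := tendsto_nhds_unique (h1.congr' h2) hu.tendsto_wronskian_star_self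
  have h4 : (inner ℂ (f : L2Neg) (opHminus a b u f) : ℂ).im = 0 := by
    rw [sub_eq_zero, ← inner_conj_symm] at h3
    exact Complex.conj_eq_iff_im.1 h3
  have h5 := abs_im_mul_norm_le h4 z₀
  rw [hT, sub_self, norm_zero] at h5
  have h6 : ‖(f : L2Neg)‖ = 0 := by
    have := abs_pos.2 hz₀
    nlinarith [norm_nonneg (f : L2Neg)]
  rw [norm_eq_zero] at h6
  have h7 : u (-1) = 0 := by
    have := congrFun hf ⟨-1, by norm_num⟩
    rw [h6] at this
    exact this.symm
  exact hu.nontrivial (eq_zero_of_solution ha hu.solution h7 (by simpa using h0))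

/-- For `f` in the maximal domain the limit of `W(u, f)` at `-∞` is continuous in the graph
norm. -/
theorem IsBoundarySolution.tendsto_wronskian (hu : IsBoundarySolution a b z₀ atBot u)
    (f g : L2Neg) (hfg : tauNeg a b f = g) :
    Tendsto (wronskian a u (extendNeg f)) atBot
      (𝓝 (-(a (-1) * u 0 * f ⟨-1, by norm_num⟩) -
        inner ℂ hu.conjVec (g - z₀ • f))) := by
  have e : ∀ n : {n : ℤ // n < 0}, u n * tau a b (extendNeg f) n - tau a b u n * extendNeg f n =
      u n * (g - z₀ • f : L2Neg) n := by
    intro n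
    rw [hu.solution, extendNeg_apply, lp.coeFn_sub, lp.coeFn_smul, ← hfg]
    simp only [tauNeg_eq, restrNeg_apply, Pi.sub_apply, Pi.smul_apply, smul_eq_mul]
    ring
  have h1 : Summable fun n : {n : ℤ // n < 0} =>
      u n * tau a b (extendNeg f) n - tau a b u n * extendNeg f n := by
    simp only [e]
    exact summable_mul_of_memlp hu.mem_nearDomain.1 (lp.memℓp (g - z₀ • f))
  convert! Jacobi.tendsto_wronskian h1 using 2
  rw [inner_eq_tsum_mul, wronskian_apply, neg_add_cancel, extendNeg_zero_apply,
    extendNeg_of_lt _ (by norm_num : (-1 : ℤ) < 0)]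
  simp only [e, star_star, hu.conjVec_apply]
  ring

theorem IsBoundarySolution.boundary_eq_zero (hu : IsBoundarySolution a b z₀ atBot u)
    (f : (opHminus a b u).domain) :
    -(a (-1) * u 0 * (f : L2Neg) ⟨-1, by norm_num⟩) -
      inner ℂ hu.conjVec
        (opHminus a b u f - z₀ • (f : L2Neg)) = 0 :=
  tendsto_nhds_unique (hu.tendsto_wronskian f (opHminus a b u f) rfl) f.2.2

theorem tendsto_lp_apply {F : ℕ → L2Neg} {f : L2Neg} (h : Tendsto F atTop (𝓝 f))
    (n : {n : ℤ // n < 0}) : Tendsto (fun k => F k n) atTop (𝓝 (f n)) := by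
  have h1 := (lp.uniformContinuous_coe (E := fun _ : {n : ℤ // n < 0} => ℂ) (p := 2)).continuous
  exact tendsto_pi_nhds.1 ((h1.tendsto f).comp h) n

theorem IsBoundarySolution.isClosed (hu : IsBoundarySolution a b z₀ atBot u) :
    (opHminus a b u).IsClosed := by
  refine IsSeqClosed.isClosed fun p q hp hpq => ?_
  obtain ⟨x, y⟩ := q
  choose f hf hTf using fun k => (opHminus a b u).mem_graph_iff.1 (hp k)
  have hx : Tendsto (fun k => (f k : L2Neg)) atTop (𝓝 x) := by
    simp only [hf]
    exact (continuous_fst.tendsto _).comp hpq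
  have hy : Tendsto (fun k => opHminus a b u (f k)) atTop (𝓝 y) := by
    simp only [hTf]
    exact (continuous_snd.tendsto _).comp hpq
  have hxn : ∀ n : ℤ, Tendsto (fun k => extendNeg (f k : L2Neg) n) atTop (𝓝 (extendNeg x n)) := by
    intro n
    rcases lt_or_ge n 0 with hn | hn
    · simp only [extendNeg_of_lt _ hn]
      exact tendsto_lp_apply hx _
    · simp only [extendNeg_of_nonneg _ hn]
      exact tendsto_const_nhds
  have hxy : tauNeg a b x = y := by
    funext n
    refine tendsto_nhds_unique ?_ (tendsto_lp_apply hy n)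
    simp only [opHminus_apply, tauNeg_eq, restrNeg_apply, tau_apply]
    exact (((hxn _).const_mul _).add ((hxn _).const_mul _)).add ((hxn _).const_mul _)
  have hmem : x ∈ (opHminus a b u).domain := by
    refine ⟨?_, ?_⟩
    · rw [hxy]; exact lp.memℓp y
    · convert! hu.tendsto_wronskian x y hxy using 2
      have h1 := fun k => hu.boundary_eq_zero (f k)
      refine tendsto_nhds_unique (l := (atTop : Filter ℕ))
        (tendsto_const_nhds.congr fun k => (h1 k).symm) ?_
      exact ((tendsto_lp_apply hx _).const_mul _).neg.sub
        (tendsto_const_nhds.inner (hy.sub (hx.const_smul z₀)))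
  exact (opHminus a b u).mem_graph_iff.2 ⟨⟨x, hmem⟩, rfl, lp.ext hxy⟩

theorem IsBoundarySolution.isFormalAdjoint (ha : ∀ n, 0 < a n) (hz₀ : z₀.im ≠ 0)
    (hu : IsBoundarySolution a b z₀ atBot u) :
    (opHminus a b u).IsFormalAdjoint (opHminus a b u) := by
  -- The elements that are multiples of `u` near `-∞` form a core on which symmetry is clear.
  let D : Set (opHminus a b u).domain :=
    {f | ∃ c : ℂ, extendNeg (f : L2Neg) =ᶠ[atBot] c • u}
  have hD : ∀ f ∈ D, ∀ g ∈ D,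
      inner ℂ (opHminus a b u f) (g : L2Neg) = inner ℂ (f : L2Neg) (opHminus a b u g) := by
    rintro f ⟨c, hf⟩ g ⟨d, hg⟩
    rw [← sub_eq_zero]
    refine tendsto_nhds_unique (tendsto_wronskian_star f g) ?_
    have h1 : Tendsto (fun n => star c * d * wronskian a (star u) u n) atBot (𝓝 0) := by
      simpa using hu.tendsto_wronskian_star_self.const_mul (star c * d)
    refine h1.congr' ?_
    obtain ⟨N, hN⟩ := eventually_atBot.1 (hf.and hg)
    filter_upwards [eventually_le_atBot (N - 1)] with n hn
    simp only [wronskian_apply, Pi.star_apply]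
    rw [(hN n (by omega)).1, (hN n (by omega)).2, (hN (n + 1) (by omega)).1,
      (hN (n + 1) (by omega)).2]
    simp only [Pi.smul_apply, smul_eq_mul, star_mul]
    ring
  have hDS : ∀ g ∈ finSupp, ∃ f ∈ D, opHminus a b u f - z₀ • (f : L2Neg) = g ∧
      ‖(f : L2Neg)‖ ≤ |z₀.im|⁻¹ * ‖g‖ := by
    intro g hg
    obtain ⟨f, hfD, hf⟩ := exists_preimage_finSupp ha hu.solution hu.mem_nearDomain
      (hu.apply_zero_ne_zero ha hz₀) hg
    refine ⟨f, hfD, hf, ?_⟩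
    have h1 : (inner ℂ (f : L2Neg) (opHminus a b u f) : ℂ).im = 0 := by
      have := hD f hfD f hfD
      rw [← inner_conj_symm] at this
      exact Complex.conj_eq_iff_im.1 this
    have h2 := abs_im_mul_norm_le h1 z₀
    rw [hf] at h2
    rw [inv_mul_eq_div, le_div_iff₀ (abs_pos.2 hz₀)]
    linarith
  have hinj : ∀ f : (opHminus a b u).domain, opHminus a b u f = z₀ • (f : L2Neg) → f = 0 := by
    intro f hf
    refine eq_zero_of_eigenvalue ha hf ?_
    have h1 := hu.boundary_eq_zero f
    rw [hf, sub_self, inner_zero_right, sub_zero, neg_eq_zero] at h1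
    exact (mul_eq_zero.1 h1).resolve_left
      (mul_ne_zero (coe_ne_zero ha _) (hu.apply_zero_ne_zero ha hz₀))
  have happrox := exists_approx hu.isClosed dense_finSupp hDS hinj
  have happrox' : ∀ f : (opHminus a b u).domain, ∃ F : ℕ → (opHminus a b u).domain,
      (∀ k, F k ∈ D) ∧ Tendsto (fun k => (F k : L2Neg)) atTop (𝓝 f) ∧
      Tendsto (fun k => opHminus a b u (F k)) atTop (𝓝 (opHminus a b u f)) := by
    intro f
    obtain ⟨f', F, h1, h2, h3, h4, -⟩ := happrox (opHminus a b u f - z₀ • (f : L2Neg))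
    have : f' - f = 0 := by
      apply hinj
      rw [LinearPMap.map_sub, Submodule.coe_sub, smul_sub, sub_eq_iff_eq_add.1 h4]
      abel
    rw [sub_eq_zero] at this
    subst this
    exact ⟨F, h1, h2, h3⟩
  intro f g
  obtain ⟨F, hF1, hF2, hF3⟩ := happrox' f
  obtain ⟨G, hG1, hG2, hG3⟩ := happrox' g
  refine tendsto_nhds_unique (hF3.inner hG2) ((hF2.inner hG3).congr fun k => ?_)
  exact (hD _ (hF1 k) _ (hG1 k)).symm

end BoundarySolution

/-! ### Growth of entire functions -/

/-- `f` is bounded by `exp (C (1 + |z|)^t)` on the whole plane. -/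
def ExpBound (t : ℝ) (f : ℂ → ℂ) : Prop :=
  ∃ C : ℝ, 0 ≤ C ∧ ∀ z, ‖f z‖ ≤ Real.exp (C * (1 + ‖z‖) ^ t)

section ExpBound

variable {t : ℝ} {f g : ℂ → ℂ}

theorem one_le_one_add_norm_rpow (ht : 0 ≤ t) (z : ℂ) : 1 ≤ (1 + ‖z‖) ^ t :=
  Real.one_le_rpow (by linarith [norm_nonneg z]) ht

theorem expBound_const (ht : 0 ≤ t) (c : ℂ) : ExpBound t fun _ => c := by
  refine ⟨‖c‖, norm_nonneg _, fun z => ?_⟩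
  have h1 := one_le_one_add_norm_rpow ht z
  have h2 := Real.add_one_le_exp (‖c‖ * (1 + ‖z‖) ^ t)
  nlinarith [norm_nonneg c]

theorem expBound_id (ht : 0 < t) : ExpBound t fun z => z := by
  refine ⟨1 / t, by positivity, fun z => ?_⟩
  have h0 : 0 < 1 + ‖z‖ := by positivity
  have h1 := Real.log_le_rpow_div h0.le ht
  have h2 : 1 + ‖z‖ ≤ Real.exp ((1 + ‖z‖) ^ t / t) := (Real.log_le_iff_le_exp h0).1 h1
  rw [one_div_mul_eq_div]
  linarith

theorem ExpBound.mul (hf : ExpBound t f) (hg : ExpBound t g) : ExpBound t fun z => f z * g z := by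
  obtain ⟨C, hC, hf⟩ := hf
  obtain ⟨D, hD, hg⟩ := hg
  refine ⟨C + D, add_nonneg hC hD, fun z => ?_⟩
  rw [norm_mul, add_mul, Real.exp_add]
  exact mul_le_mul (hf z) (hg z) (norm_nonneg _) (Real.exp_pos _).le

theorem ExpBound.add (ht : 0 ≤ t) (hf : ExpBound t f) (hg : ExpBound t g) :
    ExpBound t fun z => f z + g z := by
  obtain ⟨C, hC, hf⟩ := hf
  obtain ⟨D, hD, hg⟩ := hg
  refine ⟨C + D + 1, by positivity, fun z => ?_⟩
  set X := (1 + ‖z‖) ^ t with hX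
  have h1 : 1 ≤ X := one_le_one_add_norm_rpow ht z
  have h2 : Real.exp (C * X) ≤ Real.exp ((C + D) * X) := Real.exp_le_exp.2 (by nlinarith)
  have h3 : Real.exp (D * X) ≤ Real.exp ((C + D) * X) := Real.exp_le_exp.2 (by nlinarith)
  have h4 : 2 ≤ Real.exp X := by linarith [Real.add_one_le_exp X]
  calc ‖f z + g z‖ ≤ ‖f z‖ + ‖g z‖ := norm_add_le _ _
    _ ≤ Real.exp ((C + D) * X) * 2 := by linarith [hf z, hg z]
    _ ≤ Real.exp ((C + D) * X) * Real.exp X := by gcongr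
    _ = Real.exp ((C + D + 1) * X) := by rw [← Real.exp_add]; ring_nf

theorem ExpBound.recurrence (ht : 0 < t) (hf : ExpBound t f) (hg : ExpBound t g) (c d e : ℝ) :
    ExpBound t fun z => ((z - c) * f z - d * g z) / e := by
  have h1 := (((expBound_id ht).add ht.le (expBound_const ht.le (-c))).mul hf).add ht.le
    ((expBound_const ht.le (-d)).mul hg)
  have h2 := h1.mul (expBound_const ht.le ((e : ℂ)⁻¹))
  convert! h2 using 2 with z
  ring

end ExpBound

theorem growthOrder_le_iff {f : ℂ → ℂ} (hf : Continuous f) {s : ℝ≥0} :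
    growthOrder f ≤ s ↔ ∀ t : ℝ, s < t → ExpBound t f := by
  constructor
  · intro h t ht
    have ht0 : 0 ≤ t := s.2.trans ht.le
    lift t to ℝ≥0 using ht0
    have h1 : growthOrder f < (t : ℝ≥0∞) := h.trans_lt (by exact_mod_cast ht)
    simp only [growthOrder, iInf_lt_iff] at h1
    obtain ⟨ρ, hρ, hρt⟩ := h1
    have hρt' : (ρ : ℝ) ≤ t := by exact_mod_cast hρt.le
    obtain ⟨R, -, hR⟩ := hasBasis_cobounded_norm.eventually_iff.1 hρ
    obtain ⟨M, hM⟩ := (isCompact_closedBall (0 : ℂ) R).exists_bound_of_continuousOn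
      hf.continuousOn
    refine ⟨max 1 M, by positivity, fun z => ?_⟩
    have hX := one_le_one_add_norm_rpow (NNReal.coe_nonneg t) z
    rcases le_total R ‖z‖ with hz | hz
    · refine (hR hz).trans (Real.exp_le_exp.2 ?_)
      have h2 : ‖z‖ ^ (ρ : ℝ) ≤ (1 + ‖z‖) ^ (t : ℝ) :=
        (Real.rpow_le_rpow (norm_nonneg z) (by linarith) ρ.2).trans
          (Real.rpow_le_rpow_of_exponent_le (by linarith [norm_nonneg z]) hρt')
      nlinarith [le_max_left 1 M]
    · have h2 := hM z (by simpa using hz)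
      have h3 := Real.add_one_le_exp (max 1 M * (1 + ‖z‖) ^ (t : ℝ))
      have h4 : max 1 M * 1 ≤ max 1 M * (1 + ‖z‖) ^ (t : ℝ) := by gcongr
      linarith [le_max_right 1 M]
  · intro h
    refine ENNReal.le_of_forall_pos_le_add fun ε hε _ => ?_
    have hs : (0 : ℝ) ≤ s := s.2
    have hε' : (0 : ℝ) < ε := hε
    obtain ⟨C, hC, hCf⟩ := h (s + ε / 2) (by linarith)
    rw [← ENNReal.coe_add]
    refine iInf₂_le (s + ε) ?_
    set q : ℝ := s + ε / 2 with hq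
    have h1 : Tendsto (fun z : ℂ => ‖z‖ ^ (ε / 2 : ℝ)) (Bornology.cobounded ℂ) atTop :=
      (tendsto_rpow_atTop (by positivity)).comp tendsto_norm_cobounded_atTop
    filter_upwards [h1.eventually_ge_atTop (C * 2 ^ q),
      tendsto_norm_cobounded_atTop.eventually_ge_atTop 1] with z h2 h3
    refine (hCf z).trans (Real.exp_le_exp.2 ?_)
    calc C * (1 + ‖z‖) ^ q ≤ C * (2 * ‖z‖) ^ q := by gcongr; linarith
      _ = (C * 2 ^ q) * ‖z‖ ^ q := by
        rw [Real.mul_rpow (by norm_num) (norm_nonneg z)]; ring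
      _ ≤ ‖z‖ ^ (ε / 2 : ℝ) * ‖z‖ ^ q := by gcongr
      _ = ‖z‖ ^ (((s + ε : ℝ≥0)) : ℝ) := by
        rw [← Real.rpow_add (by linarith), hq]
        push_cast
        ring_nf

theorem one_div_one_add_rpow_le {t t' x : ℝ} (hx : 0 ≤ x) (ht : 0 ≤ t) (h : t ≤ t') :
    1 / (1 + x ^ t') ≤ 2 * (1 / (1 + x ^ t)) := by
  have h1 : 0 ≤ x ^ t := Real.rpow_nonneg hx t
  have h2 : 0 ≤ x ^ t' := Real.rpow_nonneg hx t'
  rw [mul_one_div, div_le_div_iff₀ (by positivity) (by positivity)]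
  rcases le_total x 1 with h3 | h3
  · have := Real.rpow_le_one hx h3 ht
    linarith
  · have := Real.rpow_le_rpow_of_exponent_le h3 h
    linarith

theorem convergenceExponent_le_iff {S : Set ℂ} {s : ℝ≥0} :
    convergenceExponent S ≤ s ↔
      ∀ t : ℝ, s < t → Summable fun μ : S => 1 / (1 + ‖(μ : ℂ)‖ ^ t) := by
  constructor
  · intro h t ht
    have ht0 : 0 ≤ t := s.2.trans ht.le
    lift t to ℝ≥0 using ht0
    have h1 : convergenceExponent S < (t : ℝ≥0∞) := h.trans_lt (by exact_mod_cast ht)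
    simp only [convergenceExponent, iInf_lt_iff] at h1
    obtain ⟨ρ, hρ, hρt⟩ := h1
    have hρt' : (ρ : ℝ) ≤ t := by exact_mod_cast hρt.le
    refine Summable.of_nonneg_of_le (fun μ => by positivity) (fun μ => ?_) (hρ.mul_left 2)
    exact one_div_one_add_rpow_le (norm_nonneg _) ρ.2 hρt'
  · intro h
    refine ENNReal.le_of_forall_pos_le_add fun ε hε _ => ?_
    have hε' : (0 : ℝ) < ε := hε
    rw [← ENNReal.coe_add]
    exact iInf₂_le (s + ε) (h _ (by push_cast; linarith))

/-! ### Counting the zeros of an entire function -/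

theorem exists_eq_prod_mul {f : ℂ → ℂ} (hf : Differentiable ℂ f) (A : Finset ℂ)
    (hA : ∀ a ∈ A, f a = 0) :
    ∃ h : ℂ → ℂ, Differentiable ℂ h ∧ ∀ z, f z = (∏ a ∈ A, (z - a)) * h z := by
  classical
  induction A using Finset.induction_on with
  | empty => exact ⟨f, hf, by simp⟩
  | insert a A haA ih =>
    obtain ⟨h, hh, hfh⟩ := ih fun x hx => hA x (Finset.mem_insert_of_mem hx)
    have h0 : h a = 0 := by
      have h1 := hfh a
      rw [hA a (Finset.mem_insert_self a A)] at h1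
      refine (mul_eq_zero.1 h1.symm).resolve_left (Finset.prod_ne_zero_iff.2 fun x hx => ?_)
      rw [sub_ne_zero]
      rintro rfl
      exact haA hx
    refine ⟨dslope h a, ?_, fun z => ?_⟩
    · rw [← differentiableOn_univ, Complex.differentiableOn_dslope univ_mem]
      exact hh.differentiableOn
    · rw [hfh, Finset.prod_insert haA]
      have h1 := sub_smul_dslope h a z
      rw [h0, sub_zero, smul_eq_mul] at h1
      rw [← h1]
      ring

/-- An entire function bounded by `M` on the disc of radius `4 r` around `c` satisfies
`3 ^ N |f(c)| ≤ M`, where `N` is the number of its zeros in the disc of radius `r`. -/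
theorem three_pow_card_mul_norm_le {f : ℂ → ℂ} (hf : Differentiable ℂ f) {c : ℂ} {r M : ℝ}
    (hr : 0 < r) (hM : ∀ z, ‖z - c‖ = 4 * r → ‖f z‖ ≤ M) (A : Finset ℂ)
    (hA : ∀ a ∈ A, f a = 0 ∧ ‖c - a‖ ≤ r) : 3 ^ A.card * ‖f c‖ ≤ M := by
  obtain ⟨h, hh, hfh⟩ := exists_eq_prod_mul hf A fun a ha => (hA a ha).1
  have h1 : ∀ z ∈ frontier (Metric.ball c (4 * r)), ‖h z‖ ≤ M / (3 * r) ^ A.card := by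
    intro z hz
    rw [frontier_ball _ (by positivity), mem_sphere_iff_norm] at hz
    have h2 := hM z hz
    rw [hfh, norm_mul, norm_prod] at h2
    have h3 : (3 * r) ^ A.card ≤ ∏ a ∈ A, ‖z - a‖ := by
      rw [← Finset.prod_const]
      refine Finset.prod_le_prod (fun _ _ => by positivity) fun a ha => ?_
      have h4 : z - c = (z - a) - (c - a) := by ring
      have h5 := norm_sub_le (z - a) (c - a)
      rw [← h4, hz] at h5
      linarith [(hA a ha).2]
    rw [le_div_iff₀ (by positivity), mul_comm]
    exact (mul_le_mul_of_nonneg_right h3 (norm_nonneg _)).trans h2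
  have h2 := Complex.norm_le_of_forall_mem_frontier_norm_le Metric.isBounded_ball
    hh.diffContOnCl h1 (subset_closure (Metric.mem_ball_self (by positivity)))
  have h3 : ∏ a ∈ A, ‖c - a‖ ≤ r ^ A.card := by
    rw [← Finset.prod_const]
    exact Finset.prod_le_prod (fun _ _ => norm_nonneg _) fun a ha => (hA a ha).2
  rw [hfh c, norm_mul, norm_prod]
  rw [le_div_iff₀ (by positivity), mul_pow] at h2
  calc 3 ^ A.card * ((∏ a ∈ A, ‖c - a‖) * ‖h c‖)
      ≤ 3 ^ A.card * (r ^ A.card * ‖h c‖) := by gcongr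
    _ = ‖h c‖ * (3 ^ A.card * r ^ A.card) := by ring
    _ ≤ M := h2

theorem exists_card_zeros_le {f : ℂ → ℂ} (hf : Differentiable ℂ f) {c : ℂ} (hc : f c ≠ 0) {t : ℝ}
    (ht : 0 ≤ t) (hb : ExpBound t f) :
    ∃ K : ℝ, 0 ≤ K ∧ ∀ r : ℝ, 0 ≤ r → ∀ A : Finset ℂ, (∀ a ∈ A, f a = 0 ∧ ‖a‖ ≤ r) →
      (A.card : ℝ) ≤ K * (1 + r) ^ t := by
  obtain ⟨C, hC, hCf⟩ := hb
  set L : ℝ := 5 + 5 * ‖c‖ with hL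
  have hL0 : 0 ≤ L := by positivity
  refine ⟨C * L ^ t + |Real.log ‖f c‖|, by positivity, fun r hr A hA => ?_⟩
  set R : ℝ := 1 + r + ‖c‖ with hR
  have hRpos : 0 < R := by positivity
  have h1 := three_pow_card_mul_norm_le hf (c := c) (r := R)
    (M := Real.exp (C * (L * (1 + r)) ^ t)) hRpos ?_ A ?_
  · have hc' : 0 < ‖f c‖ := norm_pos_iff.2 hc
    have h2 := Real.log_le_log (by positivity) h1
    rw [Real.log_exp, Real.log_mul (by positivity) hc'.ne', Real.log_pow,
      Real.mul_rpow hL0 (by positivity)] at h2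
    have h3 : 1 ≤ Real.log 3 := by
      rw [Real.le_log_iff_exp_le (by norm_num)]
      exact Real.exp_one_lt_d9.le.trans (by norm_num)
    have h4 : 1 ≤ (1 + r) ^ t := Real.one_le_rpow (by linarith) ht
    have h5 : (A.card : ℝ) ≤ A.card * Real.log 3 := le_mul_of_one_le_right (by positivity) h3
    have h6 := neg_abs_le (Real.log ‖f c‖)
    nlinarith [abs_nonneg (Real.log ‖f c‖)]
  · intro z hz
    refine (hCf z).trans (Real.exp_le_exp.2 ?_)
    have h2 : ‖z‖ ≤ ‖z - c‖ + ‖c‖ := by simpa using norm_add_le (z - c) c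
    have h3 : 1 + ‖z‖ ≤ L * (1 + r) := by
      rw [hz] at h2
      nlinarith [norm_nonneg c]
    gcongr
  · intro a ha
    refine ⟨(hA a ha).1, ?_⟩
    have := norm_sub_le c a
    linarith [(hA a ha).2]

/-- A set with at most `K (1 + r)^t` points in each disc `|z| ≤ r` has convergence exponent at
most `t`; the sum is estimated over dyadic annuli. -/
theorem summable_of_card_le {S : Set ℂ} {K t t' : ℝ} (hK : 0 ≤ K) (ht : 0 ≤ t) (htt' : t < t')
    (h : ∀ r : ℝ, 0 ≤ r → ∀ A : Finset ℂ, (∀ a ∈ A, a ∈ S ∧ ‖a‖ ≤ r) →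
      (A.card : ℝ) ≤ K * (1 + r) ^ t) :
    Summable fun μ : S => 1 / (1 + ‖(μ : ℂ)‖ ^ t') := by
  classical
  have ht' : 0 ≤ t' := ht.trans htt'.le
  choose k hk1 hk2 using fun z : ℂ =>
    exists_nat_pow_near (x := 1 + ‖z‖) (y := (2 : ℝ)) (by linarith [norm_nonneg z]) (by norm_num)
  set q : ℝ := 2 ^ (t - t') with hq
  have hq0 : 0 < q := by positivity
  have hq1 : q < 1 := Real.rpow_lt_one_of_one_lt_of_neg (by norm_num) (by linarith)
  set D : ℝ := K * 4 ^ t * 2 ^ t' with hD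
  have hD0 : 0 ≤ D := by positivity
  have hterm : ∀ z : ℂ, 1 / (1 + ‖z‖ ^ t') ≤ 2 ^ t' * (2 ^ (k z) : ℝ) ^ (-t') := by
    intro z
    have h0 := norm_nonneg z
    have h1 : (2 ^ (k z) : ℝ) ^ t' ≤ 2 ^ t' * (1 + ‖z‖ ^ t') := by
      calc (2 ^ (k z) : ℝ) ^ t' ≤ (1 + ‖z‖) ^ t' := by gcongr; exact hk1 z
        _ ≤ (2 * max 1 ‖z‖) ^ t' := by
          gcongr
          linarith [le_max_left 1 ‖z‖, le_max_right 1 ‖z‖]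
        _ = 2 ^ t' * (max 1 ‖z‖) ^ t' := by rw [Real.mul_rpow (by norm_num) (by positivity)]
        _ ≤ 2 ^ t' * (1 + ‖z‖ ^ t') := by
          gcongr
          have := Real.rpow_nonneg h0 t'
          rcases max_cases 1 ‖z‖ with ⟨e, -⟩ | ⟨e, -⟩ <;> rw [e]
          · rw [Real.one_rpow]; linarith
          · linarith
    have h2 : 0 ≤ ‖z‖ ^ t' := Real.rpow_nonneg h0 t'
    rw [Real.rpow_neg (by positivity), ← div_eq_mul_inv,
      div_le_div_iff₀ (by positivity) (by positivity), one_mul]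
    exact h1
  have hgeom : Summable fun j : ℕ => D * q ^ j :=
    (summable_geometric_of_lt_one hq0.le hq1).mul_left D
  refine summable_of_sum_le (c := ∑' j : ℕ, D * q ^ j)
    (fun μ => by simp only [Pi.zero_apply]; positivity) fun A => ?_
  rw [← Finset.sum_fiberwise_of_maps_to (s := A) (t := A.image fun μ : S => k μ)
    (g := fun μ : S => k μ) (fun i hi => Finset.mem_image_of_mem _ hi)]
  refine le_trans (Finset.sum_le_sum fun j _ => ?_)
    (hgeom.sum_le_tsum (A.image fun μ : S => k μ) fun j _ => by positivity)
  set B := A.filter fun μ : S => k μ = j with hB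
  have h1 : (B.card : ℝ) ≤ K * (1 + 2 ^ (j + 1)) ^ t := by
    have := h (2 ^ (j + 1)) (by positivity) (B.map (Function.Embedding.subtype _)) ?_
    · rwa [Finset.card_map] at this
    · intro a ha
      obtain ⟨μ, hμ, rfl⟩ := Finset.mem_map.1 ha
      refine ⟨μ.2, ?_⟩
      have h2 := hk2 μ
      rw [(Finset.mem_filter.1 hμ).2] at h2
      simp only [Function.Embedding.subtype_apply]
      linarith
  have h2 : ((1 : ℝ) + 2 ^ (j + 1)) ^ t ≤ 4 ^ t * (2 ^ j : ℝ) ^ t := by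
    rw [← Real.mul_rpow (by norm_num) (by positivity)]
    gcongr
    have : (1 : ℝ) ≤ 2 ^ j := one_le_pow₀ (by norm_num)
    rw [pow_succ]
    linarith
  have h3 : ((2 : ℝ) ^ j) ^ t * (2 ^ j : ℝ) ^ (-t') = q ^ j := by
    rw [← Real.rpow_add (by positivity), hq, ← Real.rpow_natCast, ← Real.rpow_natCast,
      ← Real.rpow_mul (by norm_num), ← Real.rpow_mul (by norm_num), mul_comm (j : ℝ),
      sub_eq_add_neg]
  calc ∑ μ ∈ B, 1 / (1 + ‖(μ : ℂ)‖ ^ t') ≤ ∑ μ ∈ B, 2 ^ t' * (2 ^ j : ℝ) ^ (-t') := by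
        refine Finset.sum_le_sum fun μ hμ => ?_
        have := hterm μ
        rwa [(Finset.mem_filter.1 hμ).2] at this
    _ = B.card * (2 ^ t' * (2 ^ j : ℝ) ^ (-t')) := by rw [Finset.sum_const, nsmul_eq_mul]
    _ ≤ (K * (4 ^ t * (2 ^ j : ℝ) ^ t)) * (2 ^ t' * (2 ^ j : ℝ) ^ (-t')) := by
        gcongr
        exact h1.trans (by gcongr)
    _ = D * (((2 : ℝ) ^ j) ^ t * (2 ^ j : ℝ) ^ (-t')) := by rw [hD]; ring
    _ = D * q ^ j := by rw [h3]

/-! ### Canonical products -/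

/-- The Weierstrass elementary factor `(1 - w) exp (w + w² / 2 + ⋯ + w^p / p)`. -/
noncomputable def elementaryFactor (p : ℕ) (w : ℂ) : ℂ :=
  (1 - w) * Complex.exp (-Complex.logTaylor (p + 1) (-w))

theorem elementaryFactor_zero_right (p : ℕ) : elementaryFactor p 0 = 1 := by
  simp [elementaryFactor, Complex.logTaylor_at_zero]

theorem elementaryFactor_ne_zero {p : ℕ} {w : ℂ} (hw : w ≠ 1) : elementaryFactor p w ≠ 0 :=
  mul_ne_zero (sub_ne_zero.2 hw.symm) (Complex.exp_ne_zero _)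

theorem differentiable_logTaylor (n : ℕ) : Differentiable ℂ (Complex.logTaylor n) := by
  unfold Complex.logTaylor
  fun_prop

theorem differentiable_elementaryFactor (p : ℕ) : Differentiable ℂ (elementaryFactor p) := by
  have := differentiable_logTaylor (p + 1)
  unfold elementaryFactor
  fun_prop

theorem conj_elementaryFactor (p : ℕ) (w : ℂ) :
    (starRingEnd ℂ) (elementaryFactor p w) = elementaryFactor p ((starRingEnd ℂ) w) := by
  simp only [elementaryFactor, map_mul, map_sub, map_one, ← Complex.exp_conj, map_neg,
    Complex.logTaylor, map_sum, map_div₀, map_pow, map_natCast]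

/-- Near `0` the exponent is the Taylor remainder of order `p + 1` of `log (1 - w)`. -/
theorem exists_elementaryFactor_eq_exp (p : ℕ) {w : ℂ} (hw : ‖w‖ ≤ 1 / 2) :
    ∃ δ : ℂ, elementaryFactor p w = Complex.exp δ ∧ ‖δ‖ ≤ 2 * ‖w‖ ^ (p + 1) := by
  refine ⟨Complex.log (1 + -w) - Complex.logTaylor (p + 1) (-w), ?_, ?_⟩
  · rw [sub_eq_add_neg, Complex.exp_add, Complex.exp_log, elementaryFactor, sub_eq_add_neg]
    intro h
    have h1 : w = 1 := by linear_combination -h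
    rw [h1, norm_one] at hw
    norm_num at hw
  · refine (Complex.norm_log_sub_logTaylor_le p (by rw [norm_neg]; linarith)).trans ?_
    rw [norm_neg]
    have h1 : (1 - ‖w‖)⁻¹ ≤ 2 := by
      rw [inv_le_comm₀ (by linarith) (by norm_num)]
      linarith
    have h2 : (1 : ℝ) ≤ p + 1 := by linarith [Nat.cast_nonneg (α := ℝ) p]
    have h3 : 0 ≤ ‖w‖ ^ (p + 1) := by positivity
    rw [div_le_iff₀ (by positivity)]
    nlinarith [mul_le_mul_of_nonneg_left h1 h3]

theorem norm_elementaryFactor_sub_one_le (p : ℕ) {w : ℂ} (hw : ‖w‖ ≤ 1 / 2) :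
    ‖elementaryFactor p w - 1‖ ≤ 4 * ‖w‖ ^ (p + 1) := by
  obtain ⟨δ, h1, h2⟩ := exists_elementaryFactor_eq_exp p hw
  have h3 : ‖w‖ ^ (p + 1) ≤ 1 / 2 := by
    rw [pow_succ]
    have : ‖w‖ ^ p ≤ 1 := pow_le_one₀ (norm_nonneg _) (by linarith)
    nlinarith [norm_nonneg w]
  rw [h1]
  have := Complex.norm_exp_sub_one_le (x := δ) (by linarith)
  linarith

/-- Global bound for elementary factors of genus `p`, for exponents between `p` and `p + 1`. -/
theorem exists_norm_elementaryFactor_le (p : ℕ) {t : ℝ} (ht0 : 0 < t) (hpt : p ≤ t)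
    (htp : t ≤ p + 1) :
    ∃ C : ℝ, 0 ≤ C ∧ ∀ w, ‖elementaryFactor p w‖ ≤ Real.exp (C * ‖w‖ ^ t) := by
  refine ⟨2 + 3 ^ t / t + (p + 1) * 2 ^ t, by positivity, fun w => ?_⟩
  rcases le_total ‖w‖ (1 / 2) with hw | hw
  · obtain ⟨δ, h1, h2⟩ := exists_elementaryFactor_eq_exp p hw
    rw [h1]
    refine (Complex.norm_exp_le_exp_norm _).trans (Real.exp_le_exp.2 (h2.trans ?_))
    have h3 : ‖w‖ ^ (p + 1) ≤ ‖w‖ ^ t := by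
      rcases (norm_nonneg w).eq_or_lt with h0 | h0
      · rw [← h0, Real.zero_rpow ht0.ne']
        simp
      · rw [← Real.rpow_natCast]
        refine Real.rpow_le_rpow_of_exponent_ge h0 (by linarith) ?_
        push_cast
        exact htp
    have h4 : 0 ≤ 3 ^ t / t + (p + 1) * (2 : ℝ) ^ t := by positivity
    have h5 : 0 ≤ ‖w‖ ^ t := by positivity
    nlinarith [mul_nonneg h4 h5]
  · have hw0 : 0 < ‖w‖ := by linarith
    have h1 : ‖1 - w‖ ≤ Real.exp (3 ^ t / t * ‖w‖ ^ t) := by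
      have h2 : ‖1 - w‖ ≤ 3 * ‖w‖ := by
        have := norm_sub_le (1 : ℂ) w
        rw [norm_one] at this
        linarith
      refine h2.trans ((Real.log_le_iff_le_exp (by positivity)).1 ?_)
      refine (Real.log_le_rpow_div (by positivity) ht0).trans (le_of_eq ?_)
      rw [Real.mul_rpow (by norm_num) hw0.le]
      ring
    have h2 : ‖-Complex.logTaylor (p + 1) (-w)‖ ≤ (p + 1) * 2 ^ t * ‖w‖ ^ t := by
      rw [norm_neg, Complex.logTaylor]
      refine (norm_sum_le _ _).trans ?_
      have h3 : ∀ j ∈ Finset.range (p + 1),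
          ‖(-1 : ℂ) ^ (j + 1) * (-w) ^ j / j‖ ≤ (2 * ‖w‖) ^ t := by
        intro j hj
        rw [norm_div, norm_mul, norm_pow, norm_pow, norm_neg, norm_neg, norm_one, one_pow, one_mul,
          Complex.norm_natCast]
        rcases Nat.eq_zero_or_pos j with rfl | hj0
        · simp only [CharP.cast_eq_zero, div_zero]
          positivity
        · have h4 : (1 : ℝ) ≤ j := by exact_mod_cast hj0
          have h5 : (j : ℝ) ≤ t := by
            have : j ≤ p := by simpa [Nat.lt_succ_iff] using hj
            exact (Nat.cast_le.2 this).trans hpt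
          calc ‖w‖ ^ j / j ≤ ‖w‖ ^ j := div_le_self (by positivity) h4
            _ ≤ (2 * ‖w‖) ^ j := by gcongr; linarith
            _ = (2 * ‖w‖) ^ (j : ℝ) := (Real.rpow_natCast _ _).symm
            _ ≤ (2 * ‖w‖) ^ t := Real.rpow_le_rpow_of_exponent_le (by linarith) h5
      refine (Finset.sum_le_sum h3).trans (le_of_eq ?_)
      rw [Finset.sum_const, Finset.card_range, nsmul_eq_mul, Real.mul_rpow (by norm_num) hw0.le]
      push_cast
      ring
    rw [elementaryFactor, norm_mul]
    calc ‖1 - w‖ * ‖Complex.exp (-Complex.logTaylor (p + 1) (-w))‖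
        ≤ Real.exp (3 ^ t / t * ‖w‖ ^ t) * Real.exp ((p + 1) * 2 ^ t * ‖w‖ ^ t) := by
          gcongr
          exact (Complex.norm_exp_le_exp_norm _).trans (Real.exp_le_exp.2 h2)
      _ ≤ _ := by
        rw [← Real.exp_add]
        refine Real.exp_le_exp.2 ?_
        have : 0 ≤ ‖w‖ ^ t := by positivity
        nlinarith

/-- The canonical product of genus `p` whose zeros are the numbers `1 / d i` with `d i ≠ 0`.
Indexing by inverses makes deleting a zero the same as setting `d i = 0`. -/
noncomputable def canonicalProduct {ι : Type*} (p : ℕ) (d : ι → ℂ) (z : ℂ) : ℂ :=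
  ∏' i, elementaryFactor p (d i * z)

section CanonicalProduct

variable {ι : Type*} {p : ℕ} {d : ι → ℂ}

theorem eventually_norm_elementaryFactor_sub_one_le (hd : Summable fun i => ‖d i‖ ^ (p + 1))
    (R : ℝ) : ∀ᶠ i in cofinite, ∀ z ∈ Metric.ball (0 : ℂ) R,
      ‖elementaryFactor p (d i * z) - 1‖ ≤ 4 * R ^ (p + 1) * ‖d i‖ ^ (p + 1) := by
  have h1 := hd.tendsto_cofinite_zero
  set ε : ℝ := (1 / (2 * (|R| + 1))) with hε
  have hε0 : 0 < ε := by positivity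
  filter_upwards [h1.eventually (gt_mem_nhds (pow_pos hε0 (p + 1)))] with i hi z hz
  have hz' : ‖z‖ < R := by simpa using hz
  have hR : 0 < R := (norm_nonneg z).trans_lt hz'
  have h2 : ‖d i‖ < ε := lt_of_pow_lt_pow_left₀ _ hε0.le hi
  have h3 : ‖d i * z‖ ≤ 1 / 2 := by
    rw [norm_mul]
    rw [hε, abs_of_pos hR, lt_div_iff₀ (by positivity)] at h2
    nlinarith [norm_nonneg (d i), norm_nonneg z]
  refine (norm_elementaryFactor_sub_one_le p h3).trans ?_
  rw [norm_mul, mul_pow]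
  have h4 : ‖z‖ ^ (p + 1) ≤ R ^ (p + 1) := by gcongr
  have h5 : 0 ≤ ‖d i‖ ^ (p + 1) := by positivity
  nlinarith [mul_le_mul_of_nonneg_left h4 h5]

theorem summable_norm_elementaryFactor_sub_one (hd : Summable fun i => ‖d i‖ ^ (p + 1)) (z : ℂ) :
    Summable fun i => ‖elementaryFactor p (d i * z) - 1‖ := by
  have h1 := eventually_norm_elementaryFactor_sub_one_le hd (‖z‖ + 1)
  refine Summable.of_norm_bounded_eventually (hd.mul_left (4 * (‖z‖ + 1) ^ (p + 1))) ?_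
  filter_upwards [h1] with i hi
  rw [norm_norm]
  exact hi z (by simp)

theorem multipliable_elementaryFactor (hd : Summable fun i => ‖d i‖ ^ (p + 1)) (z : ℂ) :
    Multipliable fun i => elementaryFactor p (d i * z) := by
  have := multipliable_one_add_of_summable (summable_norm_elementaryFactor_sub_one hd z)
  simpa using this

theorem differentiable_canonicalProduct (hd : Summable fun i => ‖d i‖ ^ (p + 1)) :
    Differentiable ℂ (canonicalProduct p d) := by
  have hE := differentiable_elementaryFactor p
  intro z
  have h1 := Summable.hasProdLocallyUniformlyOn_one_add (K := Metric.ball (0 : ℂ) (‖z‖ + 1))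
    (f := fun i z => elementaryFactor p (d i * z) - 1) Metric.isOpen_ball
    (hd.mul_left (4 * (‖z‖ + 1) ^ (p + 1)))
    (eventually_norm_elementaryFactor_sub_one_le hd (‖z‖ + 1))
    (fun i => Continuous.continuousOn (by have := hE.continuous; fun_prop))
  have h2 : DifferentiableOn ℂ (canonicalProduct p d) (Metric.ball (0 : ℂ) (‖z‖ + 1)) := by
    have h3 := TendstoLocallyUniformlyOn.differentiableOn h1 (Eventually.of_forall fun s => ?_)
      Metric.isOpen_ball
    · simpa [canonicalProduct] using! h3
    · refine Differentiable.differentiableOn ?_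
      refine Differentiable.fun_finsetProd fun i _ => ?_
      fun_prop
  exact h2.differentiableAt (Metric.isOpen_ball.mem_nhds (by simp))

theorem canonicalProduct_ne_zero (hd : Summable fun i => ‖d i‖ ^ (p + 1)) {z : ℂ}
    (hz : ∀ i, d i * z ≠ 1) : canonicalProduct p d z ≠ 0 := by
  have h := tprod_one_add_ne_zero_of_summable (f := fun i => elementaryFactor p (d i * z) - 1)
    (fun i => by simpa using elementaryFactor_ne_zero (hz i))
    (summable_norm_elementaryFactor_sub_one hd z)
  simpa [canonicalProduct] using h

theorem canonicalProduct_eq_mul [DecidableEq ι] (hd : Summable fun i => ‖d i‖ ^ (p + 1)) (i : ι)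
    (z : ℂ) : canonicalProduct p d z =
      elementaryFactor p (d i * z) * canonicalProduct p (Function.update d i 0) z := by
  have hu : Function.update (fun j => elementaryFactor p (d j * z)) i 1 =
      fun j => elementaryFactor p (Function.update d i 0 j * z) := by
    funext j
    rcases eq_or_ne j i with rfl | h
    · simp [elementaryFactor_zero_right]
    · simp [h]
  have hm : Multipliable (Function.update (fun j => elementaryFactor p (d j * z)) i 1) := by
    rw [hu]
    refine multipliable_elementaryFactor (Summable.of_nonneg_of_le (fun _ => by positivity)
      (fun j => ?_) hd) z
    rcases eq_or_ne j i with rfl | h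
    · simp
    · simp [h]
  rw [canonicalProduct, Multipliable.tprod_eq_mul_tprod_ite' i hm, canonicalProduct, ← hu]
  congr 1
  refine tprod_congr fun j => ?_
  rw [Function.update_apply]

theorem im_canonicalProduct (hd : Summable fun i => ‖d i‖ ^ (p + 1))
    (hdr : ∀ i, (starRingEnd ℂ) (d i) = d i) (x : ℝ) : (canonicalProduct p d x).im = 0 := by
  rw [← Complex.conj_eq_iff_im, canonicalProduct,
    (multipliable_elementaryFactor hd x).map_tprod (starRingEnd ℂ) Complex.continuous_conj]
  refine tprod_congr fun i => ?_
  rw [conj_elementaryFactor, map_mul, hdr, Complex.conj_ofReal]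

theorem expBound_canonicalProduct (hd : Summable fun i => ‖d i‖ ^ (p + 1)) {t : ℝ} (ht0 : 0 < t)
    (hpt : p ≤ t) (htp : t ≤ p + 1) (hdt : Summable fun i => ‖d i‖ ^ t) :
    ExpBound t (canonicalProduct p d) := by
  obtain ⟨C, hC, hCE⟩ := exists_norm_elementaryFactor_le p ht0 hpt htp
  have hs : 0 ≤ ∑' i, ‖d i‖ ^ t := tsum_nonneg fun i => by positivity
  refine ⟨C * ∑' i, ‖d i‖ ^ t, by positivity, fun z => ?_⟩
  have h1 := (multipliable_elementaryFactor hd z).hasProd.norm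
  refine le_of_tendsto h1 (Eventually.of_forall fun s => ?_)
  calc ∏ i ∈ s, ‖elementaryFactor p (d i * z)‖
      ≤ ∏ i ∈ s, Real.exp (C * ‖d i * z‖ ^ t) :=
        Finset.prod_le_prod (fun _ _ => norm_nonneg _) fun i _ => hCE _
    _ = Real.exp (∑ i ∈ s, C * ‖d i * z‖ ^ t) := (Real.exp_sum _ _).symm
    _ ≤ Real.exp (C * (∑' i, ‖d i‖ ^ t) * (1 + ‖z‖) ^ t) := by
      refine Real.exp_le_exp.2 ?_
      have h2 : ∑ i ∈ s, C * ‖d i * z‖ ^ t = C * (∑ i ∈ s, ‖d i‖ ^ t) * ‖z‖ ^ t := by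
        rw [mul_assoc, Finset.sum_mul, Finset.mul_sum]
        refine Finset.sum_congr rfl fun i _ => ?_
        rw [norm_mul, Real.mul_rpow (norm_nonneg _) (norm_nonneg _)]
      rw [h2]
      gcongr
      · exact hdt.sum_le_tsum s fun i _ => by positivity
      · linarith

end CanonicalProduct

theorem summable_norm_inv_rpow {S : Set ℂ} {t : ℝ}
    (h : Summable fun μ : S => 1 / (1 + ‖(μ : ℂ)‖ ^ t)) :
    Summable fun μ : S => ‖(μ : ℂ)⁻¹‖ ^ t := by
  refine Summable.of_norm_bounded_eventually (h.mul_left 2) ?_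
  filter_upwards [h.tendsto_cofinite_zero.eventually (gt_mem_nhds (by norm_num : (0 : ℝ) < 1 / 2))]
    with μ hμ
  have h0 : 0 ≤ ‖(μ : ℂ)‖ ^ t := by positivity
  rw [div_lt_div_iff₀ (by positivity) (by norm_num)] at hμ
  rw [norm_inv, Real.inv_rpow (norm_nonneg _), Real.norm_of_nonneg (by positivity), mul_one_div,
    inv_eq_one_div, div_le_div_iff₀ (by linarith) (by linarith)]
  linarith

/-- A set of convergence exponent at most `s` is the set of zeros, all of them simple, of an entire
function of growth order at most `s`. -/
theorem exists_entire_of_zeros {S : Set ℂ} (hS : ∀ μ ∈ S, μ.im = 0) {s : ℝ} (hs : 0 ≤ s)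
    (h : ∀ t : ℝ, s < t → Summable fun μ : S => 1 / (1 + ‖(μ : ℂ)‖ ^ t)) :
    ∃ α : ℂ → ℂ, Differentiable ℂ α ∧ (∀ x : ℝ, (α x).im = 0) ∧
      (∀ t : ℝ, s < t → ExpBound t α) ∧ (∀ z ∉ S, α z ≠ 0) ∧
      ∀ μ ∈ S, ∃ β : ℂ → ℂ, Continuous β ∧ β μ ≠ 0 ∧ ∀ z, α z = (z - μ) * β z := by
  classical
  set p := ⌊s⌋₊ with hp
  have hps : p ≤ s := Nat.floor_le hs
  have hsp : s < p + 1 := Nat.lt_floor_add_one s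
  let d : S → ℂ := fun μ => (μ : ℂ)⁻¹
  have hdt : ∀ t : ℝ, s < t → Summable fun i => ‖d i‖ ^ t := fun t ht =>
    summable_norm_inv_rpow (h t ht)
  have hd : Summable fun i => ‖d i‖ ^ (p + 1) := by
    refine (hdt (p + 1) hsp).congr fun i => ?_
    rw [← Real.rpow_natCast]
    push_cast
    rfl
  have hdr : ∀ i, (starRingEnd ℂ) (d i) = d i := by
    intro i
    simp only [d, map_inv₀, Complex.conj_eq_iff_im.2 (hS i i.2)]
  set F := canonicalProduct p d with hF
  have hFd : Differentiable ℂ F := differentiable_canonicalProduct hd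
  have hFb : ∀ t : ℝ, s < t → ExpBound t F := by
    intro t ht
    have h1 : s < min t (p + 1) := lt_min ht hsp
    obtain ⟨C, hC, hCb⟩ := expBound_canonicalProduct hd (hs.trans_lt h1) (hps.trans h1.le)
      (min_le_right _ _) (hdt _ h1)
    refine ⟨C, hC, fun z => (hCb z).trans (Real.exp_le_exp.2 ?_)⟩
    gcongr
    · linarith [norm_nonneg z]
    · exact min_le_left _ _
  -- The point `0` contributes the trivial factor to the product and is added by hand.
  set e : ℂ → ℂ := fun z => if (0 : ℂ) ∈ S then z else 1 with he
  have hed : Differentiable ℂ e := by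
    by_cases h0 : (0 : ℂ) ∈ S
    · simp [he, h0]
    · simp [he, h0]
  have he0 : ∀ z, z ≠ 0 → e z ≠ 0 := by
    intro z hz
    by_cases h0 : (0 : ℂ) ∈ S <;> simp [he, h0, hz]
  have hF0 : ∀ z, (z ∉ S ∨ z = 0) → F z ≠ 0 := by
    intro z hz
    refine canonicalProduct_ne_zero hd fun i hi => ?_
    have h1 : (i : ℂ) ≠ 0 := by
      intro h0
      simp [d, h0] at hi
    have h2 : z = i := by
      simp only [d] at hi
      field_simp at hi
      exact hi
    rcases hz with hz | hz
    · exact hz (h2 ▸ i.2)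
    · exact h1 (h2 ▸ hz)
  refine ⟨fun z => e z * F z, hed.mul hFd, ?_, ?_, ?_, ?_⟩
  · intro x
    have h1 : (e x).im = 0 := by by_cases h0 : (0 : ℂ) ∈ S <;> simp [he, h0]
    rw [Complex.mul_im, h1, im_canonicalProduct hd hdr]
    simp
  · intro t ht
    refine ExpBound.mul ?_ (hFb t ht)
    by_cases h0 : (0 : ℂ) ∈ S
    · simpa [he, h0] using expBound_id (hs.trans_lt ht)
    · simpa [he, h0] using expBound_const (hs.trans ht.le) 1
  · intro z hz
    refine mul_ne_zero ?_ (hF0 z (Or.inl hz))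
    by_cases h0 : (0 : ℂ) ∈ S
    · exact he0 z fun h1 => hz (h1 ▸ h0)
    · simp [he, h0]
  · intro μ hμ
    rcases eq_or_ne μ 0 with rfl | hμ0
    · refine ⟨F, hFd.continuous, hF0 0 (Or.inr rfl), fun z => ?_⟩
      simp [he, hμ]
    · set d' := Function.update d ⟨μ, hμ⟩ 0 with hd'
      have hds : Summable fun i => ‖d' i‖ ^ (p + 1) := by
        refine Summable.of_nonneg_of_le (fun _ => by positivity) (fun j => ?_) hd
        rcases eq_or_ne j ⟨μ, hμ⟩ with rfl | h
        · simp [hd']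
        · simp [hd', h]
      refine ⟨fun z => e z * (-μ⁻¹ * Complex.exp (-Complex.logTaylor (p + 1) (-(μ⁻¹ * z))) *
        canonicalProduct p d' z), ?_, ?_, fun z => ?_⟩
      · have h1 := (differentiable_logTaylor (p + 1)).continuous
        have h2 := (differentiable_canonicalProduct hds).continuous
        have h3 := hed.continuous
        fun_prop
      · refine mul_ne_zero (he0 _ hμ0) (mul_ne_zero (mul_ne_zero
          (neg_ne_zero.2 (inv_ne_zero hμ0)) (Complex.exp_ne_zero _)) ?_)
        refine canonicalProduct_ne_zero hds fun i hi => ?_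
        rcases eq_or_ne i ⟨μ, hμ⟩ with rfl | h
        · simp [hd'] at hi
        · have h1 : (i : ℂ) ≠ 0 := by
            intro h0
            simp [hd', h, d, h0] at hi
          simp only [hd', Function.update_of_ne h, d] at hi
          field_simp at hi
          exact h (Subtype.ext hi.symm)
      · have h1 : 1 - μ⁻¹ * z = (z - μ) * -μ⁻¹ := by
          field_simp
          ring
        have h2 : d ⟨μ, hμ⟩ = μ⁻¹ := rfl
        change e z * canonicalProduct p d z = _
        rw [canonicalProduct_eq_mul hd ⟨μ, hμ⟩ z, ← hd', elementaryFactor, h2, h1]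
        ring

/-! ### The spectrum in terms of an entire solution -/

section EntireSolution

variable {a b : ℤ → ℝ} {u : ℤ → ℂ} {φ : ℂ → ℤ → ℂ}

theorem exists_eigenvector (ha : ∀ n, 0 < a n) {z : ℂ} {v : ℤ → ℂ} (hv : tau a b v = z • v)
    (hv0 : v ≠ 0) (hvd : v ∈ nearDomain a b u) (h : v 0 = 0) :
    ∃ f : (opHminus a b u).domain, opHminus a b u f = z • (f : L2Neg) ∧ (f : L2Neg) ≠ 0 := by
  obtain ⟨f, hf, hTf⟩ := exists_domain_of_mem_nearDomain hvd h
  refine ⟨f, ?_, fun h0 => hv0 ?_⟩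
  · apply lp.ext
    rw [hTf, lp.coeFn_smul, hf, hv, map_smul]
  · refine eq_zero_of_solution ha hv (N := -1) ?_ (by simpa using h)
    have := congrFun hf ⟨-1, by norm_num⟩
    rw [h0] at this
    exact this.symm

/-- For finitely supported `g` the equation `(H₋ - z) f = g` has a solution that depends
holomorphically on `z` away from the zeros of `φ(·, 0)`. -/
theorem exists_holomorphic_preimage (ha : ∀ n, 0 < a n)
    (hφe : ∀ n, Differentiable ℂ fun z => φ z n) (hφ : ∀ z, tau a b (φ z) = z • φ z)
    (hφd : ∀ z, φ z ∈ nearDomain a b u) {g : L2Neg} (hg : g ∈ finSupp) :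
    ∃ F : ℂ → (opHminus a b u).domain,
      (∀ z, φ z 0 ≠ 0 → opHminus a b u (F z) - z • (F z : L2Neg) = g) ∧
      ∀ n, DifferentiableOn ℂ (fun z => (F z : L2Neg) n) {z | φ z 0 ≠ 0} := by
  classical
  induction hg using Submodule.span_induction with
  | mem g hg =>
    obtain ⟨m, rfl⟩ := hg
    obtain ⟨P, hPd, hP⟩ := exists_inhomogeneous ha (b := b) m
    have h := fun (z : ℂ) (hz : φ z 0 ≠ 0) =>
      exists_preimage_single (hφ z) (hφd z) hz (hP z).1 (hP z).2
    choose F hF1 hF2 hF3 using h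
    refine ⟨fun z => if hz : φ z 0 ≠ 0 then F z hz else 0, fun z hz => ?_, fun n => ?_⟩
    · simp only [dif_pos hz]
      exact hF3 z hz
    · have h1 : DifferentiableOn ℂ (fun z => P z n - P z 0 / φ z 0 * φ z n) {z | φ z 0 ≠ 0} := by
        intro z hz
        exact ((hPd n z).sub (((hPd 0 z).div (hφe 0 z) hz).mul (hφe n z))).differentiableWithinAt
      refine h1.congr fun z hz => ?_
      have hz' : φ z 0 ≠ 0 := hz
      simp only [dif_pos hz']
      exact hF1 z hz n
  | zero =>
    exact ⟨fun _ => 0, fun z _ => by simp, fun n => by simp⟩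
  | add g g' _ _ h h' =>
    obtain ⟨F, hF, hFd⟩ := h
    obtain ⟨F', hF', hFd'⟩ := h'
    refine ⟨fun z => F z + F' z, fun z hz => ?_, fun n => ?_⟩
    · rw [LinearPMap.map_add, Submodule.coe_add, smul_add, add_sub_add_comm, hF z hz, hF' z hz]
    · simp only [Submodule.coe_add, lp.coeFn_add, Pi.add_apply]
      exact (hFd n).add (hFd' n)
  | smul k g _ h =>
    obtain ⟨F, hF, hFd⟩ := h
    refine ⟨fun z => k • F z, fun z hz => ?_, fun n => ?_⟩
    · rw [LinearPMap.map_smul, Submodule.coe_smul, smul_comm z k, ← smul_sub, hF z hz]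
    · simp only [Submodule.coe_smul, lp.coeFn_smul, Pi.smul_apply]
      exact (hFd n).const_smul k

theorem differentiableOn_inner_finSupp {F : ℂ → L2Neg} {s : Set ℂ}
    (hF : ∀ n, DifferentiableOn ℂ (fun z => F z n) s) {k : L2Neg} (hk : k ∈ finSupp) :
    DifferentiableOn ℂ (fun z => (inner ℂ k (F z) : ℂ)) s := by
  induction hk using Submodule.span_induction with
  | mem k hk =>
    obtain ⟨m, rfl⟩ := hk
    have : ∀ z, (inner ℂ (lp.single 2 m (1 : ℂ) : L2Neg) (F z) : ℂ) = F z m := by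
      intro z
      rw [lp.inner_single_left, RCLike.inner_apply, map_one, mul_one]
    simp only [this]
    exact hF m
  | zero => simp
  | add k k' _ _ h h' => simpa only [inner_add_left] using h.fun_add h'
  | smul c k _ h => simpa only [inner_smul_left] using h.const_mul _

/-- Off the zeros of `φ(·, 0)` the equation `(H₋ - z) f = g` is solvable with a bound
`‖f‖ ≤ C ‖g‖`. At nonreal points symmetry gives the constant `1 / |Im z|`; the matrix elements of
the resolvent are holomorphic near a real point, so the maximum principle carries
the bound over to it. -/
theorem exists_bounded_preimage (ha : ∀ n, 0 < a n)
    (hT : (opHminus a b u).IsFormalAdjoint (opHminus a b u))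
    (hφe : ∀ n, Differentiable ℂ fun z => φ z n) (hφ : ∀ z, tau a b (φ z) = z • φ z)
    (hφd : ∀ z, φ z ∈ nearDomain a b u) {z₁ : ℂ} (hz₁ : φ z₁ 0 ≠ 0) :
    ∃ C : ℝ, ∀ g ∈ finSupp, ∃ f : (opHminus a b u).domain,
      opHminus a b u f - z₁ • (f : L2Neg) = g ∧ ‖(f : L2Neg)‖ ≤ C * ‖g‖ := by
  by_cases him : z₁.im = 0
  · obtain ⟨x, rfl⟩ : ∃ x : ℝ, z₁ = x := ⟨z₁.re, Complex.ext rfl (by simpa using him)⟩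
    obtain ⟨r, hr, hrφ⟩ : ∃ r > 0, Metric.closedBall (x : ℂ) r ⊆ {z | φ z 0 ≠ 0} :=
      Metric.nhds_basis_closedBall.mem_iff.1
        ((hφe 0).continuous.continuousAt.eventually_ne hz₁)
    refine ⟨3 / r, fun g hg => ?_⟩
    obtain ⟨F, hF, hFd⟩ := exists_holomorphic_preimage ha hφe hφ hφd hg
    refine ⟨F x, hF x hz₁, ?_⟩
    have h1 : ∀ k ∈ finSupp, ‖(inner ℂ k (F x : L2Neg) : ℂ)‖ ≤ 3 / r * ‖g‖ * ‖k‖ := by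
      intro k hk
      have h2 := norm_le_of_norm_mul_im_le (F := fun z => inner ℂ k (F z : L2Neg)) (x := x)
        (M := ‖k‖ * ‖g‖) hr ((differentiableOn_inner_finSupp hFd hk).mono hrφ) ?_ (z := x)
        (by rw [sub_self, norm_zero]; positivity)
      · refine h2.trans (le_of_eq ?_)
        ring
      · intro w hw
        have h3 := abs_im_mul_norm_le (im_inner_self_eq_zero hT (F w)) w
        rw [hF w (hrφ (by rw [mem_closedBall_iff_norm, hw]))] at h3
        have h4 := norm_inner_le_norm (𝕜 := ℂ) k (F w : L2Neg)
        calc ‖(inner ℂ k (F w : L2Neg) : ℂ)‖ * |w.im| ≤ ‖k‖ * ‖(F w : L2Neg)‖ * |w.im| := by gcongr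
          _ = ‖k‖ * (|w.im| * ‖(F w : L2Neg)‖) := by ring
          _ ≤ ‖k‖ * ‖g‖ := by gcongr
    have h2 : ∀ k : L2Neg, ‖(inner ℂ k (F x : L2Neg) : ℂ)‖ ≤ 3 / r * ‖g‖ * ‖k‖ := by
      intro k
      have hcl : IsClosed {k : L2Neg | ‖(inner ℂ k (F x : L2Neg) : ℂ)‖ ≤ 3 / r * ‖g‖ * ‖k‖} :=
        isClosed_le (by fun_prop) (by fun_prop)
      exact hcl.closure_subset_iff.2 h1 (dense_finSupp k)
    have h3 := h2 (F x)
    rw [inner_self_eq_norm_sq_to_K, norm_pow] at h3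
    simp only [RCLike.norm_ofReal, abs_norm] at h3
    rcases (norm_nonneg (F x : L2Neg)).eq_or_lt with h0 | h0
    · rw [← h0]; positivity
    · rw [sq] at h3
      exact le_of_mul_le_mul_right h3 h0
  · refine ⟨|z₁.im|⁻¹, fun g hg => ?_⟩
    obtain ⟨f, -, hf⟩ := exists_preimage_finSupp ha (hφ z₁) (hφd z₁) hz₁ hg
    refine ⟨f, hf, ?_⟩
    have h2 := abs_im_mul_norm_le (im_inner_self_eq_zero hT f) z₁
    rw [hf] at h2
    rw [inv_mul_eq_div, le_div_iff₀ (abs_pos.2 him)]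
    linarith

theorem isResolventPoint_of_ne_zero (ha : ∀ n, 0 < a n) (hcl : (opHminus a b u).IsClosed)
    (hT : (opHminus a b u).IsFormalAdjoint (opHminus a b u))
    (hφe : ∀ n, Differentiable ℂ fun z => φ z n) (hφ : ∀ z, tau a b (φ z) = z • φ z)
    (hφd : ∀ z, φ z ∈ nearDomain a b u) {z : ℂ} (hz : φ z 0 ≠ 0) :
    IsResolventPoint (opHminus a b u) z := by
  obtain ⟨C, hC⟩ := exists_bounded_preimage ha hT hφe hφ hφd hz
  have inj : ∀ f : (opHminus a b u).domain, opHminus a b u f = z • (f : L2Neg) → f = 0 := by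
    intro f hf
    by_contra hf0
    have hf0' : (f : L2Neg) ≠ 0 := fun h => hf0 (Subtype.ext h)
    have him := im_eq_zero_of_eigenvalue hT hf hf0'
    refine hf0' (dense_finSupp.eq_zero_of_inner_right (𝕜 := ℂ) fun g hg => ?_)
    obtain ⟨h, hh, -⟩ := hC g hg
    rw [← hh, inner_sub_left, inner_smul_left, hT h f, hf, inner_smul_right,
      Complex.conj_eq_iff_im.2 him, sub_self]
  refine isResolventPoint_of_bound (C := C) (fun g => ?_) inj
  obtain ⟨f, -, -, -, -, h1, h2⟩ := exists_approx hcl dense_finSupp (D := Set.univ)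
    (fun g hg => by
      obtain ⟨f, hf⟩ := hC g hg
      exact ⟨f, trivial, hf⟩) inj g
  exact ⟨f, h1, h2⟩

theorem spec_eq_zeros (ha : ∀ n, 0 < a n) (hcl : (opHminus a b u).IsClosed)
    (hT : (opHminus a b u).IsFormalAdjoint (opHminus a b u))
    (hφe : ∀ n, Differentiable ℂ fun z => φ z n) (hφ : ∀ z, tau a b (φ z) = z • φ z)
    (hφd : ∀ z, φ z ∈ nearDomain a b u) (hφ0 : ∀ z, φ z ≠ 0) :
    spec (opHminus a b u) = {z | φ z 0 = 0} := by
  ext z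
  refine ⟨fun h => ?_, fun h => ?_⟩
  · by_contra h0
    exact h (isResolventPoint_of_ne_zero ha hcl hT hφe hφ hφd h0)
  · obtain ⟨f, hf, hf0⟩ := exists_eigenvector ha (hφ z) (hφ0 z) (hφd z) h
    exact not_isResolventPoint_of_eigenvalue hf hf0

theorem finiteDimensional_eigenspace (ha : ∀ n, 0 < a n) (z : ℂ) :
    FiniteDimensional ℂ (eigenspace (opHminus a b u) z) := by
  let ev : eigenspace (opHminus a b u) z →ₗ[ℂ] ℂ :=
    { toFun := fun f => ((f : (opHminus a b u).domain) : L2Neg) ⟨-1, by norm_num⟩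
      map_add' := fun f g => rfl
      map_smul' := fun c f => rfl }
  refine FiniteDimensional.of_injective ev ((injective_iff_map_eq_zero ev).2 fun f hf => ?_)
  exact Subtype.ext (eq_zero_of_eigenvalue ha (mem_eigenspace_iff.1 f.2) hf)

theorem hasPurelyDiscreteSpectrum_of_entire (ha : ∀ n, 0 < a n)
    (hT : (opHminus a b u).IsFormalAdjoint (opHminus a b u))
    (hφe : ∀ n, Differentiable ℂ fun z => φ z n) (hφ : ∀ z, tau a b (φ z) = z • φ z)
    (hφd : ∀ z, φ z ∈ nearDomain a b u) (hφ0 : ∀ z, φ z ≠ 0)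
    (hspec : spec (opHminus a b u) = {z | φ z 0 = 0}) :
    HasPurelyDiscreteSpectrum (opHminus a b u) := by
  refine Set.Subset.antisymm (fun z hz => ?_) fun z hz => hz.1
  have hz0 : φ z 0 = 0 := by rwa [hspec] at hz
  obtain ⟨f, hf, hf0⟩ := exists_eigenvector ha (hφ z) (hφ0 z) (hφd z) hz0
  refine ⟨hz, ?_, ?_, finiteDimensional_eigenspace ha z⟩
  · have hI : φ Complex.I 0 ≠ 0 := by
      intro h
      obtain ⟨f, hf, hf0⟩ := exists_eigenvector ha (hφ _) (hφ0 _) (hφd _) h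
      simpa using im_eq_zero_of_eigenvalue hT hf hf0
    have han : AnalyticOnNhd ℂ (fun z => φ z 0) Set.univ :=
      (hφe 0).differentiableOn.analyticOnNhd isOpen_univ
    rcases (han z (Set.mem_univ z)).eventually_eq_zero_or_eventually_ne_zero with h | h
    · have := han.eqOn_zero_of_preconnected_of_eventuallyEq_zero isPreconnected_univ
        (Set.mem_univ z) h (Set.mem_univ Complex.I)
      exact absurd this hI
    · obtain ⟨ε, hε, hεz⟩ := Metric.eventually_nhds_iff.1 (eventually_nhdsWithin_iff.1 h)
      refine ⟨ε, hε, fun w hw hwz => ?_⟩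
      rw [hspec] at hw
      by_contra hne
      exact hεz hwz hne hw
  · rw [Submodule.ne_bot_iff]
    exact ⟨f, mem_eigenspace_iff.2 hf, fun h => hf0 (by rw [h]; rfl)⟩

/-- The growth order bounds the convergence exponent of the spectrum. Zeros are counted around
`i`, where `φ(·, 0)` does not vanish since the eigenvalues are real. -/
theorem convergenceExponent_spec_le (ha : ∀ n, 0 < a n)
    (hT : (opHminus a b u).IsFormalAdjoint (opHminus a b u))
    (hφe : ∀ n, Differentiable ℂ fun z => φ z n) (hφ : ∀ z, tau a b (φ z) = z • φ z)
    (hφd : ∀ z, φ z ∈ nearDomain a b u) (hφ0 : ∀ z, φ z ≠ 0)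
    (hspec : spec (opHminus a b u) = {z | φ z 0 = 0}) {s : ℝ≥0} (hs : GrowthOrderAtMost φ s) :
    convergenceExponent (spec (opHminus a b u)) ≤ s := by
  have hI : φ Complex.I 0 ≠ 0 := by
    intro h
    obtain ⟨f, hf, hf0⟩ := exists_eigenvector ha (hφ _) (hφ0 _) (hφd _) h
    simpa using im_eq_zero_of_eigenvalue hT hf hf0
  have hs0 : (0 : ℝ) ≤ s := s.2
  rw [convergenceExponent_le_iff]
  intro t ht
  obtain ⟨n, hn, hn1⟩ := hs
  rw [growthOrder_le_iff (hφe _).continuous] at hn hn1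
  set q : ℝ := (s + t) / 2 with hq
  have hsq : (s : ℝ) < q := by rw [hq]; linarith
  have hq0 : 0 < q := by linarith
  have hb : ExpBound q fun z => φ z 0 :=
    forall_of_recurrence ha hφ (Q := ExpBound q)
      (fun f g hf hg c d e => hf.recurrence hq0 hg c d e) (hn q hsq) (hn1 q hsq) 0
  obtain ⟨K, hK, hKA⟩ := exists_card_zeros_le (hφe 0) hI hq0.le hb
  refine summable_of_card_le hK hq0.le (by rw [hq]; linarith) fun r hr A hA => hKA r hr A ?_
  rw [hspec] at hA
  exact hA

end EntireSolution

/-! ### The Weyl function -/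

/-- Solutions `F w` of `(T - w) F w = g` are differentiable in `w` at a resolvent point `z`: the
resolvent identity `F w - F z = (w - z) R (F w)`, with `R` the resolvent at `z`, gives first
local boundedness, then continuity, then the derivative. -/
theorem differentiableAt_resolvent {E : Type*} [NormedAddCommGroup E] [NormedSpace ℂ E]
    {T : E →ₗ.[ℂ] E} {F : ℂ → T.domain} {g : E} {z : ℂ} (hz : IsResolventPoint T z)
    (hF : ∀ᶠ w in 𝓝 z, T (F w) - w • (F w : E) = g) :
    DifferentiableAt ℂ (fun w => (F w : E)) z := by
  obtain ⟨R, -, hR⟩ := hz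
  have hRg : (F z : E) = R g := by rw [← hR (F z), hF.self_of_nhds]
  have key : ∀ᶠ w in 𝓝 z, (F w : E) - F z = (w - z) • R (F w) := by
    filter_upwards [hF] with w hw
    rw [← hR (F w), hRg, ← map_sub, ← map_smul, hR]
    congr 1
    rw [← hw, sub_smul]
    abel
  have hbd : ∀ᶠ w in 𝓝 z, ‖(F w : E)‖ ≤ 2 * ‖(F z : E)‖ := by
    have h1 : ∀ᶠ w in 𝓝 z, ‖w - z‖ * ‖R‖ < 1 / 2 := by
      have : Tendsto (fun w => ‖w - z‖ * ‖R‖) (𝓝 z) (𝓝 (‖z - z‖ * ‖R‖)) :=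
        Continuous.tendsto (by fun_prop) z
      rw [sub_self, norm_zero, zero_mul] at this
      exact this.eventually (gt_mem_nhds (by norm_num))
    filter_upwards [h1, key] with w h1 h2
    have h3 : ‖(F w : E)‖ ≤ ‖(F w : E) - F z‖ + ‖(F z : E)‖ := by
      simpa using norm_add_le ((F w : E) - F z) (F z)
    have h4 : ‖(F w : E) - F z‖ ≤ 1 / 2 * ‖(F w : E)‖ := by
      rw [h2, norm_smul]
      calc ‖w - z‖ * ‖R (F w)‖ ≤ ‖w - z‖ * (‖R‖ * ‖(F w : E)‖) := by
            gcongr; exact R.le_opNorm _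
        _ = (‖w - z‖ * ‖R‖) * ‖(F w : E)‖ := by ring
        _ ≤ 1 / 2 * ‖(F w : E)‖ := by gcongr
    linarith
  have hcont : Tendsto (fun w => (F w : E)) (𝓝 z) (𝓝 (F z)) := by
    rw [tendsto_iff_norm_sub_tendsto_zero]
    have h1 : Tendsto (fun w => ‖w - z‖ * (‖R‖ * (2 * ‖(F z : E)‖))) (𝓝 z)
        (𝓝 (‖z - z‖ * (‖R‖ * (2 * ‖(F z : E)‖)))) := Continuous.tendsto (by fun_prop) z
    rw [sub_self, norm_zero, zero_mul] at h1
    refine squeeze_zero' (Eventually.of_forall fun _ => norm_nonneg _) ?_ h1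
    filter_upwards [key, hbd] with w h2 h3
    rw [h2, norm_smul]
    gcongr
    exact (R.le_opNorm _).trans (by gcongr)
  have hder : HasDerivAt (fun w => (F w : E)) (R (F z)) z := by
    rw [hasDerivAt_iff_tendsto_slope]
    have h1 : Tendsto (fun w => R (F w : E)) (𝓝[≠] z) (𝓝 (R (F z))) :=
      ((R.continuous.tendsto _).comp hcont).mono_left nhdsWithin_le_nhds
    refine h1.congr' ?_
    filter_upwards [key.filter_mono nhdsWithin_le_nhds, self_mem_nhdsWithin] with w h2 h3
    rw [slope, vsub_eq_sub, h2, smul_smul, inv_mul_cancel₀ (sub_ne_zero.2 h3), one_smul]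
  exact hder.differentiableAt

theorem norm_sub_re (z : ℂ) : ‖z - z.re‖ = |z.im| := by
  have h : z - z.re = z.im * Complex.I := by
    apply Complex.ext <;> simp
  rw [h]
  simp

/-- An isolated singularity on the real line of a function bounded by `1 / |Im z|` is at most a
simple pole. -/
theorem norm_mul_norm_sub_le {F : ℂ → ℂ} {x₀ ε : ℝ}
    (hF : ∀ z : ℂ, z ≠ x₀ → ‖z - x₀‖ < ε → DifferentiableAt ℂ F z)
    (hb : ∀ z : ℂ, z ≠ x₀ → ‖z - x₀‖ < ε → ‖F z‖ * |z.im| ≤ 1) {z : ℂ} (hz : z ≠ x₀)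
    (hzε : ‖z - x₀‖ < ε / 2) : ‖F z‖ * ‖z - x₀‖ ≤ 12 := by
  set d := ‖z - x₀‖ with hd
  have hd0 : 0 < d := norm_pos_iff.2 (sub_ne_zero.2 hz)
  rcases le_total (d / 8) |z.im| with h | h
  · have h1 := hb z hz (by linarith)
    nlinarith [norm_nonneg (F z)]
  -- Close to the real axis the maximum principle is applied on the disc of radius `d / 4` around
  -- `Re z`, which avoids `x₀`.
  · have hzx := norm_sub_re z
    have hx1 : 7 / 8 * d ≤ ‖(z.re : ℂ) - x₀‖ := by
      have h1 : z - x₀ = (z - z.re) + (z.re - x₀) := by ring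
      have h2 := norm_add_le (z - z.re) ((z.re : ℂ) - x₀)
      rw [← h1, hzx] at h2
      linarith
    have hx2 : ‖(z.re : ℂ) - x₀‖ ≤ d := by
      rw [hd, ← Complex.ofReal_sub, Complex.norm_real, Real.norm_eq_abs]
      simpa using Complex.abs_re_le_norm (z - x₀)
    have hw : ∀ w : ℂ, ‖w - z.re‖ ≤ d / 4 → w ≠ x₀ ∧ ‖w - x₀‖ < ε := by
      intro w hw
      refine ⟨?_, ?_⟩
      · rintro rfl
        rw [norm_sub_rev] at hw
        linarith
      · have h1 : w - x₀ = (w - z.re) + (z.re - x₀) := by ring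
        rw [h1]
        refine (norm_add_le _ _).trans_lt ?_
        linarith
    have h1 := norm_le_of_norm_mul_im_le (F := F) (x := z.re) (r := d / 4) (M := 1)
      (by positivity) (fun w hw' => ?_) (fun w hw' => ?_) (z := z) (by rw [hzx]; linarith)
    · rw [le_div_iff₀ (by positivity)] at h1
      linarith
    · obtain ⟨h2, h3⟩ := hw w (by rwa [mem_closedBall_iff_norm] at hw')
      exact (hF w h2 h3).differentiableWithinAt
    · obtain ⟨h2, h3⟩ := hw w hw'.le
      exact hb w h2 h3

/-- Removal of isolated singularities in a set `S`. -/
theorem exists_entire_extension {S : Set ℂ} (hS : ∀ z, ∀ᶠ w in 𝓝[≠] z, w ∉ S) {g : ℂ → ℂ}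
    (hg : ∀ z ∉ S, DifferentiableAt ℂ g z)
    (hb : ∀ μ ∈ S, ∃ K, ∀ᶠ z in 𝓝[≠] μ, ‖g z‖ ≤ K) :
    ∃ β : ℂ → ℂ, Differentiable ℂ β ∧ ∀ z ∉ S, β z = g z := by
  classical
  refine ⟨fun z => if z ∈ S then limUnder (𝓝[≠] z) g else g z, fun z => ?_, fun z hz => if_neg hz⟩
  by_cases hz : z ∈ S
  · obtain ⟨K, hK⟩ := hb z hz
    obtain ⟨ε, hε, hεz⟩ :=
      Metric.eventually_nhds_iff_ball.1 (eventually_nhdsWithin_iff.1 ((hS z).and hK))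
    have h1 := Complex.differentiableOn_update_limUnder_of_bddAbove (f := g)
      (Metric.ball_mem_nhds z hε)
      (fun w hw => (hg w (hεz w hw.1 hw.2).1).differentiableWithinAt)
      ⟨K, by rintro _ ⟨w, hw, rfl⟩; exact (hεz w hw.1 hw.2).2⟩
    refine (h1.differentiableAt (Metric.ball_mem_nhds z hε)).congr_of_eventuallyEq ?_
    filter_upwards [Metric.ball_mem_nhds z hε] with w hw
    rcases eq_or_ne w z with rfl | hwz
    · simp [hz]
    · rw [Function.update_of_ne hwz, if_neg (hεz w hw hwz).1]
  · refine (hg z hz).congr_of_eventuallyEq ?_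
    have h1 := eventually_nhdsWithin_iff.1 (hS z)
    filter_upwards [h1] with w hw
    rcases eq_or_ne w z with rfl | hwz
    · simp [hz]
    · simp [hw hwz]

theorem eventually_notMem_of_summable {S : Set ℂ} {t : ℝ} (ht : 0 ≤ t)
    (h : Summable fun μ : S => 1 / (1 + ‖(μ : ℂ)‖ ^ t)) (z : ℂ) : ∀ᶠ w in 𝓝[≠] z, w ∉ S := by
  set r := ‖z‖ + 1 with hr
  have h1 := h.tendsto_cofinite_zero.eventually
    (gt_mem_nhds (by positivity : (0 : ℝ) < 1 / (1 + r ^ t)))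
  have h2 : (S ∩ Metric.closedBall 0 r).Finite := by
    refine (Set.Finite.image Subtype.val h1).subset ?_
    rintro w ⟨hw, hwr⟩
    refine ⟨⟨w, hw⟩, ?_, rfl⟩
    have h3 : ‖w‖ ^ t ≤ r ^ t := Real.rpow_le_rpow (norm_nonneg w) (by simpa using hwr) ht
    simp only [Set.mem_compl_iff, Set.mem_ofPred_eq, not_lt]
    gcongr
  have h3 : ∀ᶠ w in 𝓝 z, w ∉ (S ∩ Metric.closedBall 0 r) \ {z} :=
    (h2.subset Set.sdiff_subset).isClosed.isOpen_compl.mem_nhds (by simp)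
  have h4 : ∀ᶠ w in 𝓝 z, w ∈ Metric.closedBall (0 : ℂ) r := by
    filter_upwards [Metric.ball_mem_nhds z one_pos] with w hw
    rw [mem_ball_iff_norm] at hw
    rw [mem_closedBall_zero_iff]
    have := norm_sub_norm_le w z
    linarith
  rw [eventually_nhdsWithin_iff]
  filter_upwards [h3, h4] with w h5 h6 h7 h8
  exact h5 ⟨⟨h8, h6⟩, h7⟩

/-- Multiplication by a function `m` with `|m(z)| ≤ 1 / |Im z|` does not increase the growth of an
entire function. -/
theorem ExpBound.of_norm_mul_im_le {α β : ℂ → ℂ} {t : ℝ} (ht : 0 ≤ t) (hα : ExpBound t α)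
    (hβ : Differentiable ℂ β) (h : ∀ z, ‖β z‖ * |z.im| ≤ ‖α z‖) : ExpBound t β := by
  obtain ⟨C, hC, hCα⟩ := hα
  refine ⟨C * 3 ^ t + 1, by positivity, fun z => ?_⟩
  set X := (1 + ‖z‖) ^ t with hX
  have hX1 : 1 ≤ X := one_le_one_add_norm_rpow ht z
  have h3 : (1 : ℝ) ≤ 3 ^ t := Real.one_le_rpow (by norm_num) ht
  rcases le_total 1 |z.im| with h1 | h1
  · have h2 : ‖β z‖ ≤ ‖α z‖ := by nlinarith [h z, norm_nonneg (β z)]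
    refine h2.trans ((hCα z).trans (Real.exp_le_exp.2 ?_))
    nlinarith [mul_le_mul_of_nonneg_left h3 hC]
  · have hzx := norm_sub_re z
    have h2 := norm_le_of_norm_mul_im_le (F := β) (x := z.re) (r := 2)
      (M := Real.exp (C * 3 ^ t * X)) (by norm_num) hβ.differentiableOn (fun w hw => ?_) (z := z)
      (by rw [hzx]; linarith)
    · have h4 : 2 ≤ Real.exp X := by linarith [Real.add_one_le_exp X]
      rw [add_mul, one_mul, Real.exp_add]
      nlinarith [Real.exp_pos (C * 3 ^ t * X)]
    · refine (h w).trans ((hCα w).trans (Real.exp_le_exp.2 ?_))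
      have h5 : ‖w‖ ≤ 2 + ‖z‖ := by
        have h6 := norm_add_le (w - z.re) z.re
        rw [sub_add_cancel, hw, Complex.norm_real] at h6
        exact h6.trans (by gcongr; exact Complex.abs_re_le_norm z)
      have h7 : (1 + ‖w‖) ^ t ≤ 3 ^ t * X := by
        rw [hX, ← Real.mul_rpow (by norm_num) (by positivity)]
        gcongr
        linarith [norm_nonneg z]
      rw [mul_assoc]
      gcongr

/-! ### Construction of an entire solution -/

section Construction

variable {a b : ℤ → ℝ} {u : ℤ → ℂ}

/-- The unit vector at `-1`. -/
noncomputable def unitVec : L2Neg := lp.single 2 ⟨-1, by norm_num⟩ 1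

theorem inner_unitVec_left (f : L2Neg) : (inner ℂ unitVec f : ℂ) = f ⟨-1, by norm_num⟩ := by
  rw [unitVec, lp.inner_single_left, RCLike.inner_apply, map_one, mul_one]

theorem norm_inner_unitVec_right (f : L2Neg) :
    ‖(inner ℂ f unitVec : ℂ)‖ = ‖f ⟨-1, by norm_num⟩‖ := by
  rw [norm_inner_symm, inner_unitVec_left]

theorem norm_unitVec : ‖unitVec‖ = 1 := by
  rw [unitVec, lp.norm_single (by norm_num), norm_one]

/-- Let `(H₋ - z) f = y δ₋₁`. Giving `f` the value `-y / a(-1)` at `0` makes it a solution of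
`τ f = z f` at `-1` too. A solution `v` that matches `c` times this extension at `-1` and `0`
coincides with `c f` on the half line. -/
theorem inDomainNearBot_of_values (ha : ∀ n, 0 < a n) {uPlus v : ℤ → ℂ} {z c y : ℂ}
    (hv : tau a b v = z • v) (f : (opHminus a b u).domain)
    (hf : opHminus a b u f - z • (f : L2Neg) = y • unitVec)
    (h1 : v (-1) = c * (f : L2Neg) ⟨-1, by norm_num⟩) (h0 : a (-1) * v 0 = -(c * y)) :
    InDomainNearBot a b u uPlus v := by
  set F := extendNeg (f : L2Neg) with hF
  have hF0 : F 0 = 0 := extendNeg_zero_apply _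
  have hτ : ∀ n < 0, tau a b F n = z * F n + (if n = -1 then y else 0) := by
    intro n hn
    have e : (opHminus a b u f : {n : ℤ // n < 0} → ℂ) ⟨n, hn⟩ = tau a b F n := opHminus_apply f _
    rw [← e, sub_eq_iff_eq_add.1 hf, lp.coeFn_add, lp.coeFn_smul, lp.coeFn_smul, Pi.add_apply,
      Pi.smul_apply, Pi.smul_apply, unitVec, lp.single_apply, hF, extendNeg_of_lt _ hn, add_comm]
    by_cases h : n = -1
    · subst h
      simp
    · have h' : (⟨n, hn⟩ : {n : ℤ // n < 0}) ≠ ⟨-1, by norm_num⟩ := fun e =>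
        h (congrArg Subtype.val e)
      simp [h, h']
  set D : ℤ → ℂ := v - c • F - Pi.single 0 (v 0) with hD
  have hD' : ∀ n < 0, D n = v n - c * F n := by
    intro n hn
    simp [hD, Pi.single_eq_of_ne hn.ne]
  have hD0 : D 0 = 0 := by simp [hD, hF0]
  have hzero := eq_zero_of_solution_left ha (b := b) (f := D) (z := z) (N := -1) ?_ ?_
    (by simpa using hD0)
  · refine inDomainNearBot_of_domain (c • f) ?_
    filter_upwards [eventually_lt_atBot (0 : ℤ)] with n hn
    rw [Submodule.coe_smul, lp.coeFn_smul, map_smul, Pi.smul_apply, smul_eq_mul, ← sub_eq_zero,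
      ← hD' n hn]
    exact hzero n (by omega)
  · intro n hn
    have hvn : tau a b v n = z * v n := congrFun hv n
    have h2 := hτ n (by omega)
    rw [hD' n (by omega)]
    rw [hD, map_sub, map_sub, map_smul, Pi.sub_apply, Pi.sub_apply, Pi.smul_apply, hvn, h2,
      smul_eq_mul, tau_apply]
    rw [Pi.single_eq_of_ne (i := (0 : ℤ)) (by omega : n - 1 ≠ 0),
      Pi.single_eq_of_ne (i := (0 : ℤ)) (by omega : n ≠ 0)]
    by_cases h : n = -1
    · subst h
      simp only [neg_add_cancel, Pi.single_eq_same, h0, if_true]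
      ring
    · rw [Pi.single_eq_of_ne (i := (0 : ℤ)) (by omega : n + 1 ≠ 0), if_neg h]
      ring
  · rw [hD' (-1) (by norm_num), h1, hF, extendNeg_of_lt _ (by norm_num : (-1 : ℤ) < 0), sub_self]

/-- At distance `ε` above an eigenvalue the Weyl function has modulus at least a constant times
`1 / ε`. -/
theorem norm_sq_le_weyl {T : L2Neg →ₗ.[ℂ] L2Neg} (hT : T.IsFormalAdjoint T) {μ ε : ℝ} (hε : 0 < ε)
    {ψ f : T.domain} (hψ : T ψ = (μ : ℂ) • (ψ : L2Neg))
    (hf : T f - (μ + ε * Complex.I) • (f : L2Neg) = unitVec) :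
    ‖(ψ : L2Neg) ⟨-1, by norm_num⟩‖ ^ 2 ≤
      ‖(f : L2Neg) ⟨-1, by norm_num⟩‖ * ε * ‖(ψ : L2Neg)‖ ^ 2 := by
  have h1 := im_inner_resolvent hT f (μ + ε * Complex.I)
  rw [hf, inner_unitVec_left] at h1
  have h2 : ε * ‖(f : L2Neg)‖ ^ 2 ≤ ‖(f : L2Neg) ⟨-1, by norm_num⟩‖ := by
    refine le_trans (le_of_eq ?_) (Complex.im_le_norm _)
    rw [h1]
    simp
  have h3 : ‖(ψ : L2Neg) ⟨-1, by norm_num⟩‖ = ε * ‖(inner ℂ (ψ : L2Neg) (f : L2Neg) : ℂ)‖ := by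
    rw [← norm_inner_unitVec_right, ← hf, inner_sub_right, ← hT ψ f, hψ, inner_smul_left,
      inner_smul_right, ← sub_mul, norm_mul]
    congr 1
    simp [abs_of_pos hε]
  have h4 := norm_inner_le_norm (𝕜 := ℂ) (ψ : L2Neg) (f : L2Neg)
  rw [h3]
  calc (ε * ‖(inner ℂ (ψ : L2Neg) (f : L2Neg) : ℂ)‖) ^ 2
      ≤ (ε * (‖(ψ : L2Neg)‖ * ‖(f : L2Neg)‖)) ^ 2 := by gcongr
    _ = (ε * ‖(f : L2Neg)‖ ^ 2) * ε * ‖(ψ : L2Neg)‖ ^ 2 := by ring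
    _ ≤ _ := by gcongr

theorem exists_entire_solution (ha : ∀ n, 0 < a n) (uPlus : ℤ → ℂ)
    (hT : (opHminus a b u).IsFormalAdjoint (opHminus a b u))
    (hdisc : HasPurelyDiscreteSpectrum (opHminus a b u)) {s : ℝ≥0}
    (hs : convergenceExponent (spec (opHminus a b u)) ≤ s) :
    ∃ φ : ℂ → ℤ → ℂ, IsRealEntireSolution a b φ ∧ GrowthOrderAtMost φ s ∧
      ∀ z : ℂ, φ z ≠ 0 ∧ InDomainNearBot a b u uPlus (φ z) := by
  classical
  set T := opHminus a b u
  set S := spec T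
  have hs0 : (0 : ℝ) ≤ s := s.2
  rw [convergenceExponent_le_iff] at hs
  have heig : ∀ μ ∈ S, ∃ ψ : T.domain, T ψ = μ • (ψ : L2Neg) ∧ (ψ : L2Neg) ≠ 0 := by
    intro μ hμ
    have h1 : μ ∈ discreteSpec T := hdisc ▸ hμ
    obtain ⟨ψ, hψ, hψ0⟩ := (Submodule.ne_bot_iff _).1 h1.2.2.1
    exact ⟨ψ, mem_eigenspace_iff.1 hψ, fun h => hψ0 (Subtype.ext h)⟩
  have hSreal : ∀ μ ∈ S, μ.im = 0 := by
    intro μ hμ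
    obtain ⟨ψ, hψ, hψ0⟩ := heig μ hμ
    exact im_eq_zero_of_eigenvalue hT hψ hψ0
  have hSiso : ∀ z, ∀ᶠ w in 𝓝[≠] z, w ∉ S :=
    eventually_notMem_of_summable (by linarith) (hs (s + 1) (by linarith))
  have hSopen : ∀ z ∉ S, ∀ᶠ w in 𝓝 z, w ∉ S := by
    intro z hz
    filter_upwards [eventually_nhdsWithin_iff.1 (hSiso z)] with w hw
    rcases eq_or_ne w z with rfl | h
    · exact hz
    · exact hw h
  have hres : ∀ z, z ∉ S → IsResolventPoint T z := fun z hz => not_not.1 hz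
  -- `f z = (H₋ - z)⁻¹ δ₋₁`, whose value at `-1` is the Weyl function.
  have hsol : ∀ z, z ∉ S → ∃ f : T.domain, T f - z • (f : L2Neg) = unitVec := by
    intro z hz
    obtain ⟨R, hR, -⟩ := hres z hz
    obtain ⟨h1, h2⟩ := hR unitVec
    exact ⟨_, h2⟩
  choose f' hf' using hsol
  let f : ℂ → T.domain := fun z => if hz : z ∉ S then f' z hz else 0
  have hf : ∀ z ∉ S, T (f z) - z • (f z : L2Neg) = unitVec := by
    intro z hz
    simp only [f, dif_pos hz]
    exact hf' z hz
  set m : ℂ → ℂ := fun z => (f z : L2Neg) ⟨-1, by norm_num⟩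
  have hminner : ∀ z, m z = inner ℂ unitVec (f z : L2Neg) := fun z => (inner_unitVec_left _).symm
  have hmd : ∀ z ∉ S, DifferentiableAt ℂ m z := by
    intro z hz
    have h1 : DifferentiableAt ℂ (fun w => (f w : L2Neg)) z :=
      differentiableAt_resolvent (hres z hz) ((hSopen z hz).mono fun w hw => hf w hw)
    have h2 : m = fun w => innerSL ℂ unitVec (f w : L2Neg) := by
      funext w
      rw [hminner, innerSL_apply_apply]
    rw [h2]
    exact (innerSL ℂ unitVec).differentiableAt.comp z h1
  have hmb : ∀ z ∉ S, ‖m z‖ * |z.im| ≤ 1 := by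
    intro z hz
    have h1 := abs_im_mul_norm_le (im_inner_self_eq_zero hT (f z)) z
    rw [hf z hz, norm_unitVec] at h1
    have h2 : ‖m z‖ ≤ ‖(f z : L2Neg)‖ := lp.norm_apply_le_norm (by norm_num) _ _
    nlinarith [abs_nonneg z.im]
  have hmr : ∀ x : ℝ, (x : ℂ) ∉ S → (m x).im = 0 := by
    intro x hx
    have h1 := im_inner_resolvent hT (f x) x
    rw [hf x hx, ← hminner] at h1
    simpa using h1
  obtain ⟨α, hαd, hαr, hαb, hα0, hαS⟩ := exists_entire_of_zeros hSreal hs0 hs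
  -- The poles of the Weyl function are cancelled by the zeros of `α`.
  obtain ⟨β, hβd, hβ⟩ := exists_entire_extension hSiso (g := fun z => α z * m z)
    (fun z hz => (hαd z).mul (hmd z hz)) (by
      intro μ hμ
      obtain ⟨γ, hγ, -, hαγ⟩ := hαS μ hμ
      obtain ⟨x, rfl⟩ : ∃ x : ℝ, μ = x := ⟨μ.re, Complex.ext rfl (by simpa using hSreal μ hμ)⟩
      obtain ⟨ε, hε, hεS⟩ := Metric.eventually_nhds_iff.1 (eventually_nhdsWithin_iff.1 (hSiso x))
      have hb : ∀ z : ℂ, z ≠ x → ‖z - x‖ < ε / 2 → ‖m z‖ * ‖z - x‖ ≤ 12 := fun z hz hzε =>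
        norm_mul_norm_sub_le (fun w hw hwε => hmd w (hεS (by rwa [dist_eq_norm]) hw))
          (fun w hw hwε => hmb w (hεS (by rwa [dist_eq_norm]) hw)) hz hzε
      refine ⟨(‖γ x‖ + 1) * 12, ?_⟩
      have h1 : ∀ᶠ z in 𝓝 (x : ℂ), ‖γ z‖ < ‖γ x‖ + 1 :=
        hγ.norm.continuousAt.eventually (gt_mem_nhds (by linarith))
      rw [eventually_nhdsWithin_iff]
      filter_upwards [h1, Metric.ball_mem_nhds (x : ℂ) (half_pos hε)] with z h2 h3 h4
      rw [mem_ball_iff_norm] at h3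
      rw [hαγ, norm_mul, norm_mul]
      calc ‖z - x‖ * ‖γ z‖ * ‖m z‖ = ‖γ z‖ * (‖m z‖ * ‖z - x‖) := by ring
        _ ≤ (‖γ x‖ + 1) * 12 := by
          gcongr
          exact hb z h4 h3)
  have hβim : ∀ z, ‖β z‖ * |z.im| ≤ ‖α z‖ := by
    intro z
    by_cases hz : z ∈ S
    · rw [hSreal z hz, abs_zero, mul_zero]
      exact norm_nonneg _
    · rw [hβ z hz, norm_mul, mul_assoc]
      exact mul_le_of_le_one_right (norm_nonneg _) (hmb z hz)
  have hβr : ∀ x : ℝ, (β x).im = 0 := by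
    intro x
    have h1 : Tendsto (fun y : ℝ => (β y).im) (𝓝[≠] x) (𝓝 (β x).im) := by
      have h2 : Continuous fun y : ℝ => (β y).im :=
        Complex.continuous_im.comp (hβd.continuous.comp Complex.continuous_ofReal)
      exact (h2.tendsto x).mono_left nhdsWithin_le_nhds
    have h2 : Tendsto (fun y : ℝ => (y : ℂ)) (𝓝[≠] x) (𝓝[≠] (x : ℂ)) := by
      refine tendsto_nhdsWithin_iff.2
        ⟨(Complex.continuous_ofReal.tendsto x).mono_left nhdsWithin_le_nhds, ?_⟩
      filter_upwards [self_mem_nhdsWithin] with y hy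
      simpa using hy
    refine tendsto_nhds_unique h1 (tendsto_const_nhds.congr' ?_)
    filter_upwards [h2.eventually (hSiso x)] with y hy
    rw [hβ y hy, Complex.mul_im, hαr, hmr y hy]
    simp
  -- `β` does not vanish at an eigenvalue since the Weyl function has a pole there.
  have hβ0 : ∀ μ ∈ S, β μ ≠ 0 := by
    intro μ hμ hβμ
    obtain ⟨γ, hγ, hγ0, hαγ⟩ := hαS μ hμ
    obtain ⟨ψ, hψ, hψ0⟩ := heig μ hμ
    obtain ⟨x, rfl⟩ : ∃ x : ℝ, μ = x := ⟨μ.re, Complex.ext rfl (by simpa using hSreal μ hμ)⟩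
    have hψ1 : (ψ : L2Neg) ⟨-1, by norm_num⟩ ≠ 0 := fun h =>
      hψ0 (by rw [eq_zero_of_eigenvalue ha hψ h]; rfl)
    have hpath : Tendsto (fun ε : ℝ => (x + ε * Complex.I : ℂ)) (𝓝[>] 0) (𝓝[≠] (x : ℂ)) := by
      refine tendsto_nhdsWithin_iff.2 ⟨?_, ?_⟩
      · have h1 : Continuous fun ε : ℝ => (x + ε * Complex.I : ℂ) := by fun_prop
        have h2 := h1.tendsto 0
        simp only [Complex.ofReal_zero, zero_mul, add_zero] at h2
        exact h2.mono_left nhdsWithin_le_nhds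
      · filter_upwards [self_mem_nhdsWithin] with ε hε
        have : (ε : ℂ) ≠ 0 := by exact_mod_cast (ne_of_gt hε)
        simp [this]
    have hpath' := tendsto_nhdsWithin_iff.1 hpath
    have h1 : Tendsto (fun ε : ℝ => ‖γ (x + ε * Complex.I)‖ *
        ‖(ψ : L2Neg) ⟨-1, by norm_num⟩‖ ^ 2) (𝓝[>] 0)
        (𝓝 (‖γ x‖ * ‖(ψ : L2Neg) ⟨-1, by norm_num⟩‖ ^ 2)) :=
      (((hγ.tendsto _).comp hpath'.1).norm).mul_const _
    have h2 : Tendsto (fun ε : ℝ => ‖β (x + ε * Complex.I)‖ * ‖(ψ : L2Neg)‖ ^ 2) (𝓝[>] 0)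
        (𝓝 (‖β x‖ * ‖(ψ : L2Neg)‖ ^ 2)) :=
      (((hβd.continuous.tendsto _).comp hpath'.1).norm).mul_const _
    have h3 := le_of_tendsto_of_tendsto h1 h2 (by
      filter_upwards [hpath.eventually (hSiso x), self_mem_nhdsWithin] with ε hε hε0
      have hε0' : 0 < ε := hε0
      have h4 := norm_sq_le_weyl hT hε0' hψ (hf _ hε)
      have h5 : ‖(x + ε * Complex.I : ℂ) - x‖ = ε := by simp [abs_of_pos hε0']
      rw [hβ _ hε, hαγ, norm_mul, norm_mul, h5]
      calc ‖γ (x + ε * Complex.I)‖ * ‖(ψ : L2Neg) ⟨-1, by norm_num⟩‖ ^ 2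
          ≤ ‖γ (x + ε * Complex.I)‖ * (‖m (x + ε * Complex.I)‖ * ε * ‖(ψ : L2Neg)‖ ^ 2) := by
            gcongr
        _ = _ := by ring)
    rw [hβμ, norm_zero, zero_mul] at h3
    have h4 : 0 < ‖γ x‖ := norm_pos_iff.2 hγ0
    have h5 : 0 < ‖(ψ : L2Neg) ⟨-1, by norm_num⟩‖ := norm_pos_iff.2 hψ1
    have := mul_pos h4 (pow_pos h5 2)
    linarith
  choose φ hφ hφ1 hφ0' using fun z => exists_solution ha (b := b) z (-1) (-(a (-1) * β z)) (α z)
  have hφ0 : ∀ z, φ z 0 = α z := by simpa using hφ0'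
  have hαS0 : ∀ μ ∈ S, α μ = 0 := by
    intro μ hμ
    obtain ⟨γ, -, -, hαγ⟩ := hαS μ hμ
    rw [hαγ, sub_self, zero_mul]
  have hentire : ∀ n, Differentiable ℂ fun z => φ z n := by
    refine forall_of_recurrence ha hφ ?_ (N := -1) ?_ ?_
    · intro f g hf hg c d e
      fun_prop
    · simp only [hφ1]
      fun_prop
    · simp only [hφ0']
      exact hαd
  refine ⟨φ, ⟨hentire, ?_, hφ⟩, ⟨-1, ?_, ?_⟩, fun z => ⟨fun h => ?_, ?_⟩⟩
  · refine forall_of_recurrence ha hφ (Q := fun g => ∀ x : ℝ, (g x).im = 0) ?_ (N := -1) ?_ ?_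
    · intro f g hf hg c d e x
      have h1 : f x = ((f x).re : ℂ) := Complex.ext rfl (by simpa using hf x)
      have h2 : g x = ((g x).re : ℂ) := Complex.ext rfl (by simpa using hg x)
      beta_reduce
      rw [h1, h2]
      norm_cast
    · intro x
      beta_reduce
      rw [hφ1, Complex.neg_im, Complex.im_ofReal_mul, hβr, mul_zero, neg_zero]
    · intro x
      beta_reduce
      rw [hφ0']
      exact hαr x
  · rw [growthOrder_le_iff (hentire _).continuous]
    intro t ht
    have ht0 : 0 ≤ t := hs0.trans ht.le
    have h1 := (expBound_const ht0 (-(a (-1) : ℂ))).mul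
      ((hαb t ht).of_norm_mul_im_le ht0 hβd hβim)
    convert! h1 using 2 with z
    rw [hφ1]
    ring
  · rw [growthOrder_le_iff (hentire _).continuous]
    intro t ht
    simpa only [hφ0'] using! hαb t ht
  · by_cases hz : z ∈ S
    · have h1 := hφ1 z
      rw [h, Pi.zero_apply, eq_comm, neg_eq_zero] at h1
      exact mul_ne_zero (coe_ne_zero ha _) (hβ0 z hz) h1
    · have h1 := hφ0 z
      rw [h] at h1
      exact hα0 z hz h1.symm
  · by_cases hz : z ∈ S
    · obtain ⟨ψ, hψ, hψ0⟩ := heig z hz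
      have hψ1 : (ψ : L2Neg) ⟨-1, by norm_num⟩ ≠ 0 := fun h =>
        hψ0 (by rw [eq_zero_of_eigenvalue ha hψ h]; rfl)
      refine inDomainNearBot_of_values ha (c := φ z (-1) / (ψ : L2Neg) ⟨-1, by norm_num⟩) (y := 0)
        (hφ z) ψ ?_ ?_ ?_
      · rw [zero_smul, sub_eq_zero]
        exact hψ
      · rw [div_mul_cancel₀ _ hψ1]
      · rw [hφ0, hαS0 z hz]
        simp
    · refine inDomainNearBot_of_values ha (c := -(a (-1) * α z)) (y := 1) (hφ z) (f z) ?_ ?_ ?_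
      · rw [one_smul]
        exact hf z hz
      · rw [hφ1, hβ z hz]
        ring
      · rw [hφ0]
        ring

end Construction

end Jacobi

theorem theorem3p1 (a b : ℤ → ℝ) (ha : ∀ n, 0 < a n)
    (z₀ : ℂ) (hz₀ : z₀.im ≠ 0) (uMinus uPlus : ℤ → ℂ)
    (hMinus : Jacobi.IsBoundarySolution a b z₀ atBot uMinus)
    (hPlus : Jacobi.IsBoundarySolution a b z₀ atTop uPlus)
    (s : ℝ≥0) :
    (Jacobi.HasPurelyDiscreteSpectrum (Jacobi.opHminus a b uMinus) ∧
        Jacobi.convergenceExponent (Jacobi.spec (Jacobi.opHminus a b uMinus)) ≤ s) ↔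
      ∃ φ : ℂ → ℤ → ℂ,
        Jacobi.IsRealEntireSolution a b φ ∧
        Jacobi.GrowthOrderAtMost φ s ∧
        ∀ z : ℂ, φ z ≠ 0 ∧ Jacobi.InDomainNearBot a b uMinus uPlus (φ z) := by
  have hT := hMinus.isFormalAdjoint ha hz₀
  refine ⟨fun h => Jacobi.exists_entire_solution ha uPlus hT h.1 h.2, ?_⟩
  rintro ⟨φ, hφ, hgrowth, hdom⟩
  have hφd := fun z => Jacobi.mem_nearDomain_of_inDomainNearBot (hdom z).2
  have hφ0 := fun z => (hdom z).1
  have hspec := Jacobi.spec_eq_zeros ha hMinus.isClosed hT hφ.entire hφ.solution hφd hφ0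
  exact ⟨Jacobi.hasPurelyDiscreteSpectrum_of_entire ha hT hφ.entire hφ.solution hφd hφ0 hspec,
    Jacobi.convergenceExponent_spec_le ha hT hφ.entire hφ.solution hφd hφ0 hspec hgrowth⟩
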